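/- Let $n \ge 0$ be an integer, let $G = \mathrm{Sp}(2n,\mathbb C)$ with diagonal maximal torus $T$, characters $X^*(T) = \bigoplus_{i=1}^n \mathbb Z\epsilon_i$ and positive roots $R^+ = \{\epsilon_i \pm \epsilon_j\}_{i<j} \cup \{2\epsilon_i\}$. Put $V_1 = \mathbb C^{2n}$, $V_2 = (\wedge^2 V_1)/\mathbb C\omega$, where $\omega \in \wedge^2 V_1$ is the $G$-invariant vector dual to the symplectic form, and $\mathbb V = V_1 \oplus V_2$. For $\lambda \in X^*(T)$ write $\mathbb V[\lambda]$ for the $\lambda$-weight space of $\mathbb V$, let $$\mathbb V^+ = \bigoplus_{\lambda \in \mathbb Q_{\ge 0}R^+ \setminus \{0\}} \mathbb V[\lambda],$$ and let $\mathfrak N = G\,\mathbb V^+ \subset \mathbb V$ (the exotic nilpotent cone, the image of $G \times^B \mathbb V^+ \to \mathbb V$, where $B \supset T$ is the Borel subgroup determined by $R^+$). For every $\lambda \neq 0$ with $\mathbb V[\lambda] \ne 0$ fix a basis vector $\mathbf v[\lambda]$ of the one-dimensional space $\mathbb V[\lambda]$. A marked partition of $n$ is a pair $(\lambda, a)$ consisting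 of a partition $\lambda = (\lambda_1 \ge \lambda_2 \ge \cdots)$ of $n$ (followed by zeros) and a sequence of integers $a = (a_1, a_2, \ldots)$ such that 1. $0 \le a_k \le \lambda_k$ for all $k$; 2. $a_k = 0$ whenever $\lambda_{k+1} = \lambda_k$; 3. $\lambda_p - \lambda_q > a_p - a_q > 0$ whenever $p < q$, $a_p \neq 0$ and $a_q \ne 0$. Let $\mathcal{MP}(n)$ be the set of marked partitions of $n$. For $(\lambda,a) \in \mathcal{MP}(n)$ put $$J(\lambda, a) = \sum_{p \ge 1} \Big( (1-\delta_{a_p,0})\,\mathbf v[\epsilon_{\lambda_p^< + a_p}] + \sum_{k=1}^{\lambda_p - 1} \mathbf v[\epsilon_{\lambda_p^<+k} - \epsilon_{\lambda_p^<+k+1}] \Big), \qquad \lambda_p^< = \sum_{q<p}\lambda_q,$$ where the first term is $0$ if $a_p = 0$. Then $J(\lambda,a) \in \mathbb V^+ \subset \mathfrak N$. **Theorem.** The map $$\mathbf J : \mathcal{MP}(n) \longrightarrow G\backslash \mathfrak N, \qquad (\lambda, a) \longmapsto G\,J(\lambda,a),$$ is surjective; that is, every $G$-orbit in $\mathfrak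 N$ contains $J(\lambda,a)$ for some marked partition $(\lambda,a)$ of $n$. -/

import Mathlib

namespace ExoticCone

open scoped Matrix

/-- The complex symplectic group `Sp(2n, ℂ)`, as a group of matrices indexed by `Fin n ⊕ Fin n`. -/
abbrev G (n : ℕ) : Type := Matrix.symplecticGroup (Fin n) ℂ

/-- The vector representation `V₁ = ℂ²ⁿ`, with the action `g • x = g *ᵥ x` provided by Mathlib. -/
abbrev V₁ (n : ℕ) : Type := Fin n ⊕ Fin n → ℂ

/-- `∧² V₁`. -/
abbrev Wedge (n : ℕ) : Type := ⋀[ℂ]^2 (V₁ n)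

/-- The vector `x ∧ y` of `∧² V₁`. -/
noncomputable def wedge {n : ℕ} (x y : V₁ n) : Wedge n := exteriorPower.ιMulti ℂ 2 ![x, y]

/-- The standard basis of `V₁`; `Sum.inl i` and `Sum.inr i` index the two dual Lagrangian halves. -/
def stdVec {n : ℕ} (s : Fin n ⊕ Fin n) : V₁ n := Pi.single s 1

/-- The invariant vector `∑ eᵢ ∧ fᵢ` of `∧² V₁`. -/
noncomputable def omega (n : ℕ) : Wedge n :=
  ∑ i : Fin n, wedge (stdVec (Sum.inl i)) (stdVec (Sum.inr i))

/-- `∧² g` acting on `∧² V₁`. -/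
noncomputable def wedgeMap {n : ℕ} (g : G n) : Wedge n →ₗ[ℂ] Wedge n :=
  exteriorPower.map 2 (Matrix.mulVecLin (g : Matrix (Fin n ⊕ Fin n) (Fin n ⊕ Fin n) ℂ))

theorem wedgeMap_wedge {n : ℕ} (g : G n) (x y : V₁ n) :
    wedgeMap g (wedge x y) = wedge (g • x) (g • y) := by
  unfold wedgeMap wedge
  rw [exteriorPower.map_apply_ιMulti]
  congr 1
  funext i
  fin_cases i <;> rfl

theorem wedgeMap_one {n : ℕ} : wedgeMap (1 : G n) = LinearMap.id := by
  have h : Matrix.mulVecLin ((1 : G n) : Matrix (Fin n ⊕ Fin n) (Fin n ⊕ Fin n) ℂ)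
      = LinearMap.id := by
    ext; simp
  rw [wedgeMap, h, exteriorPower.map_id]

theorem wedgeMap_mul {n : ℕ} (g h : G n) : wedgeMap (g * h) = wedgeMap g ∘ₗ wedgeMap h := by
  simp only [wedgeMap, Submonoid.coe_mul, Matrix.mulVecLin_mul]
  rw [exteriorPower.map_comp]

theorem update_pair_zero {n : ℕ} (x y z : V₁ n) : Function.update ![x, y] 0 z = ![z, y] := by
  funext i; fin_cases i <;> simp

theorem update_pair_one {n : ℕ} (x y z : V₁ n) : Function.update ![x, y] 1 z = ![x, z] := by
  funext i; fin_cases i <;> simp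

/-- The bilinear map `(x, y) ↦ x ∧ y`. -/
noncomputable def wedgeBilin (n : ℕ) : V₁ n →ₗ[ℂ] V₁ n →ₗ[ℂ] Wedge n :=
  LinearMap.mk₂ ℂ wedge
    (fun x x' y => by
      have h := (exteriorPower.ιMulti ℂ 2).map_update_add ![x, y] 0 x x'
      rwa [update_pair_zero, update_pair_zero, update_pair_zero] at h)
    (fun c x y => by
      have h := (exteriorPower.ιMulti ℂ 2).map_update_smul ![x, y] 0 c x
      rwa [update_pair_zero, update_pair_zero] at h)
    (fun x y y' => by
      have h := (exteriorPower.ιMulti ℂ 2).map_update_add ![x, y] 1 y y'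
      rwa [update_pair_one, update_pair_one, update_pair_one] at h)
    (fun c x y => by
      have h := (exteriorPower.ιMulti ℂ 2).map_update_smul ![x, y] 1 c y
      rwa [update_pair_one, update_pair_one] at h)

theorem wedge_swap {n : ℕ} (x y : V₁ n) : wedge y x = - wedge x y := by
  have := (exteriorPower.ιMulti (R := ℂ) (M := V₁ n) 2).map_swap ![x, y]
    (i := 0) (j := 1) (by decide)
  have h2 : (![x, y] ∘ Equiv.swap (0 : Fin 2) 1) = ![y, x] := by
    funext i; fin_cases i <;> simp
  rw [h2] at this
  exact this

theorem two_omega (n : ℕ) :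
    (2 : ℂ) • omega n = - ∑ s, ∑ t, Matrix.J (Fin n) ℂ s t • wedge (stdVec s) (stdVec t) := by
  have h : ∀ i : Fin n, wedge (stdVec (Sum.inr i)) (stdVec (Sum.inl i)) =
      - wedge (stdVec (Sum.inl i)) (stdVec (Sum.inr i)) := fun i => wedge_swap _ _
  simp [Matrix.J, Fintype.sum_sum_type, Matrix.one_apply, omega, two_smul, ite_smul, h,
    apply_ite]
  rw [← Finset.sum_neg_distrib]
  refine Finset.sum_congr rfl fun i _ => ?_
  module

theorem smul_stdVec {n : ℕ} (g : G n) (s : Fin n ⊕ Fin n) :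
    g • (stdVec s : V₁ n) = ∑ a, (g : Matrix (Fin n ⊕ Fin n) (Fin n ⊕ Fin n) ℂ) a s • stdVec a := by
  funext b
  change ((g : Matrix (Fin n ⊕ Fin n) (Fin n ⊕ Fin n) ℂ) *ᵥ (Pi.single s 1)) b = _
  simp [stdVec, Finset.sum_apply, Pi.single_apply]

theorem wedgeMap_omega {n : ℕ} (g : G n) : wedgeMap g (omega n) = omega n := by
  have key : (2 : ℂ) • wedgeMap g (omega n) = (2 : ℂ) • omega n := by
    rw [← map_smul, two_omega, map_neg, map_sum]
    congr 1
    have hg := SymplecticGroup.mem_iff.mp g.2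
    have hterm : ∀ s t, wedgeMap g (wedge (stdVec s) (stdVec t)) =
        ∑ a, ∑ b, (g.1 a s * g.1 b t) • wedge (stdVec a) (stdVec b) := by
      intro s t
      rw [wedgeMap_wedge, smul_stdVec, smul_stdVec]
      change wedgeBilin n _ _ = _
      simp only [map_sum, LinearMap.sum_apply, map_smul, LinearMap.smul_apply,
        Finset.smul_sum, smul_smul]
      rw [Finset.sum_comm]
      refine Finset.sum_congr rfl fun a _ => Finset.sum_congr rfl fun b _ => ?_
      rw [mul_comm]
      rfl
    simp only [map_sum, map_smul, hterm, Finset.smul_sum, smul_smul]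
    have hcoef : ∀ a b, Matrix.J (Fin n) ℂ a b =
        ∑ s, ∑ t, Matrix.J (Fin n) ℂ s t * (g.1 a s * g.1 b t) := by
      intro a b
      conv_lhs => rw [← hg]
      simp only [Matrix.mul_apply, Matrix.transpose_apply, Finset.sum_mul]
      rw [Finset.sum_comm]
      refine Finset.sum_congr rfl fun s _ => Finset.sum_congr rfl fun t _ => ?_
      ring
    have hR : ∀ a b, Matrix.J (Fin n) ℂ a b • wedge (stdVec a) (stdVec b : V₁ n) =
        ∑ s, ∑ t, (Matrix.J (Fin n) ℂ s t * (g.1 a s * g.1 b t)) •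
          wedge (stdVec a) (stdVec b) := by
      intro a b
      conv_lhs => rw [hcoef a b]
      simp only [Finset.sum_smul]
    simp only [hR]
    calc _ = ∑ s, ∑ a, ∑ t, ∑ b, (Matrix.J (Fin n) ℂ s t * (g.1 a s * g.1 b t)) •
          wedge (stdVec a) (stdVec b) := Finset.sum_congr rfl fun s _ => Finset.sum_comm
      _ = ∑ a, ∑ s, ∑ b, ∑ t, (Matrix.J (Fin n) ℂ s t * (g.1 a s * g.1 b t)) •
          wedge (stdVec a) (stdVec b) := by
        rw [Finset.sum_comm]
        exact Finset.sum_congr rfl fun a _ => Finset.sum_congr rfl fun s _ => Finset.sum_comm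
      _ = _ := Finset.sum_congr rfl fun a _ => Finset.sum_comm
  exact smul_right_injective _ (two_ne_zero) key

/-- `V₂ = (∧² V₁) / ℂ`, the quotient by the trivial line. -/
abbrev V₂ (n : ℕ) : Type := Wedge n ⧸ Submodule.span ℂ {omega n}

theorem span_omega_le_comap {n : ℕ} (g : G n) :
    Submodule.span ℂ {omega n} ≤ (Submodule.span ℂ {omega n}).comap (wedgeMap g) := by
  rw [Submodule.span_singleton_le_iff_mem, Submodule.mem_comap, wedgeMap_omega]
  exact Submodule.mem_span_singleton_self _

/-- The action of `g` on `V₂` induced by `∧² g`. -/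
noncomputable def actV₂ {n : ℕ} (g : G n) : V₂ n →ₗ[ℂ] V₂ n :=
  Submodule.mapQ _ _ (wedgeMap g) (span_omega_le_comap g)

noncomputable instance {n : ℕ} : DistribMulAction (G n) (V₂ n) where
  smul g x := actV₂ g x
  one_smul x := by
    change actV₂ 1 x = x
    obtain ⟨y, rfl⟩ := Submodule.Quotient.mk_surjective _ x
    simp [actV₂, wedgeMap_one]
  mul_smul g h x := by
    change actV₂ (g * h) x = actV₂ g (actV₂ h x)
    obtain ⟨y, rfl⟩ := Submodule.Quotient.mk_surjective _ x
    simp [actV₂, wedgeMap_mul]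
  smul_zero g := map_zero (actV₂ g)
  smul_add g := map_add (actV₂ g)

instance {n : ℕ} : SMulCommClass (G n) ℂ (V₂ n) where
  smul_comm g c x := map_smul (actV₂ g) c x

/-- The representation `𝕍 = V₁ ⊕ V₂`, with the componentwise action of `G`. -/
abbrev V (n : ℕ) : Type := V₁ n × V₂ n

/-- The element `diag(t₁, …, tₙ, t₁⁻¹, …, tₙ⁻¹)` of the diagonal maximal torus `T`. -/
noncomputable def torus {n : ℕ} (t : Fin n → ℂˣ) : G n :=
  ⟨Matrix.diagonal (Sum.elim (fun i => (t i : ℂ)) (fun i => ((t i)⁻¹ : ℂˣ))), by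
    rw [SymplecticGroup.mem_iff]
    ext (i | i) (j | j) <;>
      simp [Matrix.J, Matrix.mul_apply, Matrix.diagonal_apply, Matrix.one_apply] <;>
      split_ifs with h <;> simp [h]⟩

/-- Characters of `T`: the vector `l = ∑ lᵢ εᵢ` stands for the character `t ↦ ∏ tᵢ ^ lᵢ`. -/
abbrev Weight (n : ℕ) : Type := Fin n → ℤ

/-- The weight space `𝕍[l]`. -/
noncomputable def weightSpace {n : ℕ} (l : Weight n) : Submodule ℂ (V n) where
  carrier := {x | ∀ t : Fin n → ℂˣ, torus t • x = ((∏ i, t i ^ l i : ℂˣ) : ℂ) • x}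
  zero_mem' := fun t => by rw [smul_zero, smul_zero]
  add_mem' := fun hx hy t => by rw [smul_add, hx t, hy t, smul_add]
  smul_mem' := fun c x hx t => by rw [smul_comm, hx t, smul_comm]

/-- `εₘ` for `1 ≤ m ≤ n` (numbered from `1`); it is `0` for other `m`. -/
def eps (n m : ℕ) : Weight n := fun i => if (i : ℕ) + 1 = m then 1 else 0

/-- The simple root `αₘ = εₘ - εₘ₊₁` for `1 ≤ m < n`. -/
def alpha (n m : ℕ) : Weight n := eps n m - eps n (m + 1)

/-- `R⁺ = {εᵢ ± εⱼ : i < j} ∪ {2 εᵢ}`. -/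
def posRoots (n : ℕ) : Set (Weight n) :=
  {r | ∃ i j : ℕ, 1 ≤ i ∧ i < j ∧ j ≤ n ∧ (r = eps n i + eps n j ∨ r = eps n i - eps n j)} ∪
    {r | ∃ i : ℕ, 1 ≤ i ∧ i ≤ n ∧ r = 2 • eps n i}

/-- A weight regarded as a vector with rational coordinates. -/
def toRat {n : ℕ} (l : Weight n) : Fin n → ℚ := fun i => (l i : ℚ)

/-- The weights in `ℚ_{≥ 0} R⁺ - {0}`. -/
def posWeights (n : ℕ) : Set (Weight n) :=
  {l | l ≠ 0 ∧ toRat l ∈ Submodule.span ℚ≥0 (toRat '' posRoots n)}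

/-- `𝕍⁺`, the sum of the weight spaces `𝕍[l]` over `l ∈ ℚ_{≥ 0} R⁺ - {0}`. -/
noncomputable def Vplus (n : ℕ) : Submodule ℂ (V n) := ⨆ l ∈ posWeights n, weightSpace l

/-- The exotic nilpotent cone `𝔑 = G 𝕍⁺`: the image of `G ×^B 𝕍⁺ → 𝕍`, `(g, x) ↦ g x`, as a
`G`-stable subset of `𝕍`. -/
noncomputable def nilCone (n : ℕ) : SubMulAction (G n) (V n) where
  carrier := {y | ∃ g : G n, ∃ x ∈ Vplus n, y = g • x}
  smul_mem' := by
    rintro h _ ⟨g, x, hx, rfl⟩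
    exact ⟨h * g, x, hx, (mul_smul h g x).symm⟩

/-- The set `G \ 𝔑` of `G`-orbits of `𝔑`. -/
abbrev Orbits (n : ℕ) : Type := MulAction.orbitRel.Quotient (G n) (nilCone n)

/-- A choice of a basis vector `v l` of each weight space `𝕍[l]`, `l ≠ 0`
(so `v l = 0` when `l` is not a weight of `𝕍`). -/
def IsWeightBasis {n : ℕ} (v : Weight n → V n) : Prop :=
  ∀ l : Weight n, l ≠ 0 → weightSpace l = Submodule.span ℂ {v l}

/-- The block `v^{(j)}(len)ᵢ = (1 - δ_{j,0}) v[ε_{i+j}] + ∑_{k=1}^{len-1} v[α_{i+k}]`. -/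
noncomputable def block {n : ℕ} (v : Weight n → V n) (j len i : ℕ) : V n :=
  (if j = 0 then 0 else v (eps n (i + j))) + ∑ k ∈ Finset.Ico 1 len, v (alpha n (i + k))

/-- Marked partitions of `n`. Sequences are indexed from `0`: `part p` is `λ_{p+1}` and
`mark p` is `a_{p+1}`. -/
@[ext]
structure MarkedPartition (n : ℕ) where
  part : ℕ →₀ ℕ
  mark : ℕ → ℕ
  antitone_part : Antitone part
  sum_part : (part.sum fun _ m => m) = n
  mark_le : ∀ k, mark k ≤ part k
  mark_eq_zero : ∀ k, part (k + 1) = part k → mark k = 0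
  mark_lt : ∀ p q, p < q → mark p ≠ 0 → mark q ≠ 0 →
    (part p : ℤ) - part q > (mark p : ℤ) - mark q ∧ (mark p : ℤ) - mark q > 0

/-- `λ_p^< = ∑_{q < p} λ_q`. -/
def MarkedPartition.before {n : ℕ} (m : MarkedPartition n) (p : ℕ) : ℕ :=
  ∑ q ∈ Finset.range p, m.part q

/-- `J(λ, a) = ∑_p v^{(a_p)}(λ_p)_{λ_p^<}`; the sum is over the `p` with `λ_p ≠ 0`, the other blocks
being zero. -/
noncomputable def normalForm {n : ℕ} (v : Weight n → V n) (m : MarkedPartition n) : V n :=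
  ∑ p ∈ m.part.support, block v (m.mark p) (m.part p) (m.before p)

theorem MarkedPartition.before_add_le {n : ℕ} (m : MarkedPartition n) (p : ℕ) :
    m.before p + m.part p ≤ n := by
  have h : m.before p + m.part p = ∑ q ∈ Finset.range (p + 1), m.part q :=
    (Finset.sum_range_succ _ _).symm
  rw [h]
  conv_rhs => rw [← m.sum_part]
  rw [Finsupp.sum, ← Finset.sum_filter_ne_zero]
  refine Finset.sum_le_sum_of_subset fun q hq => ?_
  simpa using (Finset.mem_filter.mp hq).2

theorem eps_mem_posWeights {n m : ℕ} (h1 : 1 ≤ m) (hm : m ≤ n) : eps n m ∈ posWeights n := by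
  refine ⟨fun h => ?_, ?_⟩
  · have := congrFun h ⟨m - 1, by omega⟩
    simp [eps, Nat.sub_add_cancel h1] at this
  · have h2 : toRat (2 • eps n m) ∈ Submodule.span ℚ≥0 (toRat '' posRoots n) :=
      Submodule.subset_span ⟨_, Or.inr ⟨m, h1, hm, rfl⟩, rfl⟩
    have h3 := Submodule.smul_mem _ (1 / 2 : ℚ≥0) h2
    convert h3 using 1
    funext i
    simp [toRat, NNRat.smul_def]

theorem alpha_mem_posWeights {n m : ℕ} (h1 : 1 ≤ m) (hm : m < n) : alpha n m ∈ posWeights n := by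
  refine ⟨fun h => ?_, ?_⟩
  · have := congrFun h ⟨m - 1, by omega⟩
    simp [alpha, eps, Nat.sub_add_cancel h1] at this
  · exact Submodule.subset_span ⟨_, Or.inl ⟨m, m + 1, h1, by omega, by omega, Or.inr rfl⟩, rfl⟩

theorem IsWeightBasis.mem_Vplus {n : ℕ} {v : Weight n → V n} (hv : IsWeightBasis v)
    {l : Weight n} (hl : l ∈ posWeights n) : v l ∈ Vplus n := by
  have h : v l ∈ weightSpace l := by
    rw [hv l hl.1]
    exact Submodule.mem_span_singleton_self _
  exact (le_iSup₂_of_le (f := fun l (_ : l ∈ posWeights n) => weightSpace l) l hl le_rfl) h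

theorem normalForm_mem_Vplus {n : ℕ} {v : Weight n → V n} (hv : IsWeightBasis v)
    (m : MarkedPartition n) : normalForm v m ∈ Vplus n := by
  refine Submodule.sum_mem _ fun p _ => ?_
  have hb := m.before_add_le p
  have ha := m.mark_le p
  refine Submodule.add_mem _ ?_ (Submodule.sum_mem _ fun k hk => ?_)
  · split_ifs with h
    · exact Submodule.zero_mem _
    · exact hv.mem_Vplus (eps_mem_posWeights (by omega) (by omega))
  · rw [Finset.mem_Ico] at hk
    exact hv.mem_Vplus (alpha_mem_posWeights (by omega) (by omega))

/-- The map `𝐉` from marked partitions to `G`-orbits of `𝔑`, `(λ, a) ↦ G J(λ, a)`. -/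
noncomputable def orbitMap {n : ℕ} {v : Weight n → V n} (hv : IsWeightBasis v)
    (m : MarkedPartition n) : Orbits n :=
  Quotient.mk _ ⟨normalForm v m, 1, normalForm v m, normalForm_mem_Vplus hv m,
    (one_smul _ _).symm⟩

end ExoticCone

/-!
The symplectic form `⟨·, ·⟩` turns `a ∧ b` into the operator `z ↦ ⟨a, z⟩ b - ⟨b, z⟩ a` on `V₁`. This
identifies `∧² V₁` with a space of self-adjoint operators (`wedgeEnd_injective`,
`wedgeEnd_selfAdjoint`), `omega` being sent to the identity. The cocharacter `(n, n - 1, …, 1)` is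
positive on `posWeights n`, so the `V₂`-component of a vector of `𝕍⁺` lifts to an element of `∧² V₁`
of positive degree, which acts nilpotently (`Vplus_snd_mem`, `wedgeEnd_isNilpotent`). The problem
becomes one of linear algebra: to bring a pair `(z, x)`, where `z` is any vector and `x` a nilpotent
self-adjoint operator on a symplectic space, to normal form.

Since `x` is self-adjoint and the form alternating, every cyclic subspace `K[x] a` is isotropic. A
vector `w` of maximal height `N` can thus be paired with some `u` so that the chains of `w` and `u`
span a nondegenerate block of dimension `2 N`, and the orthogonal complement of the block is again
`x`-stable. Inside a block, every vector is `x ^ k w'` for some `w'` of height `N`, which can replace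
`w`. By induction on the dimension, the space splits into blocks with generators `w p`, `u p` of
height `l p` such that `z = ∑ x ^ (l p - a p) (w p)` with `a p ≤ l p` (`exists_hyperbolic_adapted`).

If `a q ≤ a p` and `l p - a p ≤ l q - a q`, replacing `w p` by `w p + x ^ c (w q)` for a suitable `c`
(and correcting `u q`) absorbs the `q`-th term of `z`, so that `a q` becomes `0`
(`IsHyperbolic.exists_absorb`). When no such pair of nonzero marks is left, the data sorted by
decreasing length form a marked partition (`exists_marked_hyperbolic`). The chains, rescaled so as
to match the given weight vectors, are the columns of the symplectic matrix that carries the normal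
form to `(z, x)` (`exists_smul_normalForm`).
-/

namespace ExoticCone

open Module

open scoped Matrix

/-! ### Hyperbolic systems of chains -/

section HyperbolicSystems

variable {K W : Type*} [Field K] [AddCommGroup W] [Module K W]

/-- A *hyperbolic system* for a bilinear form `B` and an operator `x`: generators `w p`, `u p`, both
killed by `x ^ l p`, of mutually orthogonal blocks, where the chain `x ^ i (w p)` is dual to the
chain `x ^ j (u p)` up to reversal (`i + j + 1 = l p`). The equation `i + 1 = l p` is used in place
of `i = l p - 1`, so that blocks with `l p = 0` are harmless. -/
structure IsHyperbolic (B : LinearMap.BilinForm K W) (x : End K W) {ι : Type*}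
    (l : ι → ℕ) (w u : ι → W) : Prop where
  pow_w : ∀ p, (x ^ l p) (w p) = 0
  pow_u : ∀ p, (x ^ l p) (u p) = 0
  ww : ∀ p q i, B ((x ^ i) (w p)) (w q) = 0
  uu : ∀ p q i, B ((x ^ i) (u p)) (u q) = 0
  wu_ne : ∀ p q i, p ≠ q → B ((x ^ i) (w p)) (u q) = 0
  wu : ∀ p i, B ((x ^ i) (w p)) (u p) = if i + 1 = l p then 1 else 0

variable {B : LinearMap.BilinForm K W} {x : End K W}

theorem bilin_pow (hx : ∀ a b, B (x a) b = B a (x b)) (i : ℕ) (a b : W) :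
    B ((x ^ i) a) b = B a ((x ^ i) b) := by
  induction i generalizing a b with
  | zero => simp
  | succ i ih => rw [pow_succ, Module.End.mul_apply, ih, hx, ← Module.End.mul_apply, ← pow_succ',
      ← pow_succ]

theorem bilin_pow_pow (hx : ∀ a b, B (x a) b = B a (x b)) (i j : ℕ) (a b : W) :
    B ((x ^ i) a) ((x ^ j) b) = B ((x ^ (i + j)) a) b := by
  rw [← bilin_pow hx, ← Module.End.mul_apply, ← pow_add, add_comm]

/-- Every cyclic subspace `K[x] a` is isotropic. -/
theorem bilin_pow_self [NeZero (2 : K)] (hB : B.IsAlt) (hx : ∀ a b, B (x a) b = B a (x b))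
    (i : ℕ) (a : W) : B ((x ^ i) a) a = 0 := by
  have h : B ((x ^ i) a) a = -B ((x ^ i) a) a := by
    conv_lhs => rw [bilin_pow hx, ← hB.neg_eq]
  have h2 : (2 : K) * B ((x ^ i) a) a = 0 := by linear_combination h
  exact (mul_eq_zero.mp h2).resolve_left (NeZero.ne _)

theorem pow_eq_zero_of_le {i j : ℕ} (h : i ≤ j) {a : W} (ha : (x ^ i) a = 0) :
    (x ^ j) a = 0 := by
  obtain ⟨k, rfl⟩ := Nat.exists_eq_add_of_le' h
  rw [pow_add, Module.End.mul_apply, ha, map_zero]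

theorem pow_mem {M : Submodule K W} (hM : ∀ z ∈ M, x z ∈ M) (i : ℕ) {z : W} (hz : z ∈ M) :
    (x ^ i) z ∈ M := by
  induction i with
  | zero => simpa
  | succ i ih => rw [pow_succ', Module.End.mul_apply]; exact hM _ ih

/-- A vector of maximal height `N` in a nondegenerate `x`-stable subspace generates one half of a
hyperbolic block. -/
theorem exists_dual_generator (hx : ∀ a b, B (x a) b = B a (x b)) {M : Submodule K W}
    (hM : ∀ z ∈ M, x z ∈ M) (hnd : ∀ z ∈ M, (∀ z' ∈ M, B z z' = 0) → z = 0) {N : ℕ}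
    {w : W} (hw : w ∈ M) (hN : (x ^ (N + 1)) w = 0) (hw0 : (x ^ N) w ≠ 0) :
    ∃ u ∈ M, ∀ i, B ((x ^ i) w) u = if i + 1 = N + 1 then 1 else 0 := by
  have key : ∀ k ≤ N, ∃ u ∈ M, B ((x ^ N) w) u = 1 ∧
      ∀ i < N, N ≤ i + k → B ((x ^ i) w) u = 0 := by
    intro k
    induction k with
    | zero =>
      intro _
      obtain ⟨z, hz, h⟩ : ∃ z ∈ M, B ((x ^ N) w) z ≠ 0 := by
        by_contra! h
        exact hw0 (hnd _ (pow_mem hM N hw) h)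
      refine ⟨(B ((x ^ N) w) z)⁻¹ • z, M.smul_mem _ hz, ?_, fun i h1 h2 => by omega⟩
      simp [h]
    | succ k ih =>
      intro hk
      obtain ⟨u, hu, h1, h2⟩ := ih (by omega)
      -- subtract the multiple of `x ^ (k + 1) u` that clears the pairing with `x ^ (N - k - 1) w`
      refine ⟨u - B ((x ^ (N - (k + 1))) w) u • (x ^ (k + 1)) u,
        M.sub_mem hu (M.smul_mem _ (pow_mem hM _ hu)), ?_, fun i hi hik => ?_⟩
      · rw [map_sub, map_smul, bilin_pow_pow hx,
          pow_eq_zero_of_le (j := N + (k + 1)) (by omega) hN, h1]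
        simp
      · rw [map_sub, map_smul, bilin_pow_pow hx]
        rcases Nat.lt_or_ge N (i + (k + 1)) with h | h
        · rw [pow_eq_zero_of_le (j := i + (k + 1)) (by omega) hN, h2 i hi (by omega)]
          simp
        · obtain rfl : i = N - (k + 1) := by omega
          rw [show N - (k + 1) + (k + 1) = N by omega, h1]
          simp
  obtain ⟨u, hu, h1, h2⟩ := key N le_rfl
  refine ⟨u, hu, fun i => ?_⟩
  rcases lt_trichotomy i N with h | h | h
  · rw [h2 i h (by omega), if_neg (by omega)]
  · rw [h, h1, if_pos rfl]
  · rw [pow_eq_zero_of_le (by omega) hN, if_neg (by omega)]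
    simp

/-- The subspace spanned by the chains of `w` and `u`, truncated at length `N`. -/
def blockSpan (x : End K W) (N : ℕ) (w u : W) : Submodule K W :=
  Submodule.span K (Set.range (Sum.elim (fun i : Fin N => (x ^ (i : ℕ)) w)
    (fun i : Fin N => (x ^ (i : ℕ)) u)))

theorem pow_left_mem_blockSpan {N : ℕ} {w u : W} (hw : (x ^ N) w = 0) (i : ℕ) :
    (x ^ i) w ∈ blockSpan x N w u := by
  rcases Nat.lt_or_ge i N with h | h
  · exact Submodule.subset_span ⟨Sum.inl ⟨i, h⟩, rfl⟩
  · rw [pow_eq_zero_of_le h hw]; exact Submodule.zero_mem _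

theorem pow_right_mem_blockSpan {N : ℕ} {w u : W} (hu : (x ^ N) u = 0) (i : ℕ) :
    (x ^ i) u ∈ blockSpan x N w u := by
  rcases Nat.lt_or_ge i N with h | h
  · exact Submodule.subset_span ⟨Sum.inr ⟨i, h⟩, rfl⟩
  · rw [pow_eq_zero_of_le h hu]; exact Submodule.zero_mem _

theorem blockSpan_stable {N : ℕ} {w u : W} (hw : (x ^ N) w = 0) (hu : (x ^ N) u = 0) :
    ∀ z ∈ blockSpan x N w u, x z ∈ blockSpan x N w u := by
  intro z hz
  have : blockSpan x N w u ≤ (blockSpan x N w u).comap x := by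
    refine Submodule.span_le.mpr ?_
    rintro _ ⟨i | i, rfl⟩
    · simp only [Sum.elim_inl, SetLike.mem_coe, Submodule.mem_comap, ← Module.End.mul_apply,
        ← pow_succ']
      exact pow_left_mem_blockSpan hw _
    · simp only [Sum.elim_inr, SetLike.mem_coe, Submodule.mem_comap, ← Module.End.mul_apply,
        ← pow_succ']
      exact pow_right_mem_blockSpan hu _
  exact this hz

theorem blockSpan_le {N : ℕ} {w u : W} {M : Submodule K W} (hM : ∀ z ∈ M, x z ∈ M) (hw : w ∈ M)
    (hu : u ∈ M) : blockSpan x N w u ≤ M := by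
  refine Submodule.span_le.mpr ?_
  rintro _ ⟨i | i, rfl⟩
  · exact pow_mem hM _ hw
  · exact pow_mem hM _ hu

/-- A hyperbolic system with a single block, of length `N`, generated by `w` and `u`. -/
abbrev IsHyperbolicPair (B : LinearMap.BilinForm K W) (x : End K W) (N : ℕ) (w u : W) : Prop :=
  IsHyperbolic B x (fun _ : Unit => N) (fun _ => w) (fun _ => u)

theorem isHyperbolicPair_of [NeZero (2 : K)] (hB : B.IsAlt)
    (hx : ∀ a b, B (x a) b = B a (x b)) {N : ℕ} {w u : W} (hw : (x ^ N) w = 0)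
    (hu : (x ^ N) u = 0) (h : ∀ i, B ((x ^ i) w) u = if i + 1 = N then 1 else 0) :
    IsHyperbolicPair B x N w u where
  pow_w _ := hw
  pow_u _ := hu
  ww _ _ i := bilin_pow_self hB hx i w
  uu _ _ i := bilin_pow_self hB hx i u
  wu_ne p q _ hpq := absurd (Subsingleton.elim p q) hpq
  wu _ := h

section Pair

variable {N : ℕ} {w u : W} (hB : B.IsAlt) (hx : ∀ a b, B (x a) b = B a (x b))
  (h : IsHyperbolicPair B x N w u)
include hB hx h

/-- The chains of a hyperbolic pair have a dual family inside the block. -/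
theorem IsHyperbolic.dual_family (s t : Fin N ⊕ Fin N) :
    B (Sum.elim (fun i : Fin N => (x ^ (i : ℕ)) w) (fun i : Fin N => (x ^ (i : ℕ)) u) s)
      (Sum.elim (fun i : Fin N => (x ^ (N - 1 - i)) u) (fun i : Fin N => -(x ^ (N - 1 - i)) w) t)
      = if s = t then 1 else 0 := by
  have hww := h.ww () ()
  have huu := h.uu () ()
  have hwu := h.wu ()
  have huw : ∀ i, B ((x ^ i) u) w = -(if i + 1 = N then 1 else 0) := fun i => by
    rw [bilin_pow hx, ← hB.neg_eq, hwu]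
  rcases s with i | i <;> rcases t with j | j <;>
    simp only [Sum.elim_inl, Sum.elim_inr, bilin_pow_pow hx, map_neg, hww, huu, hwu, huw, neg_zero,
      neg_neg, reduceCtorEq, if_false, Sum.inl.injEq, Sum.inr.injEq, Fin.ext_iff] <;>
  · congr 1
    rw [eq_iff_iff]
    omega

/-- Coordinates on a block: every vector of `W` has an orthogonal projection to it. -/
theorem IsHyperbolic.exists_projection (z : W) :
    ∃ z' ∈ blockSpan x N w u, ∀ y ∈ blockSpan x N w u, B y (z - z') = 0 := by
  set b : Fin N ⊕ Fin N → W :=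
    Sum.elim (fun i : Fin N => (x ^ (i : ℕ)) w) (fun i : Fin N => (x ^ (i : ℕ)) u) with hb
  set b' : Fin N ⊕ Fin N → W :=
    Sum.elim (fun i : Fin N => (x ^ (N - 1 - i)) u) (fun i : Fin N => -(x ^ (N - 1 - i)) w)
    with hb'
  refine ⟨∑ t, B (b t) z • b' t, Submodule.sum_mem _ fun t _ => Submodule.smul_mem _ _ ?_, ?_⟩
  · rcases t with i | i
    · exact pow_right_mem_blockSpan (h.pow_u ()) _
    · exact Submodule.neg_mem _ (pow_left_mem_blockSpan (h.pow_w ()) _)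
  · intro y hy
    induction hy using Submodule.span_induction with
    | mem y hy =>
      obtain ⟨s, rfl⟩ := hy
      have key : ∀ t, B (b s) (b' t) = if s = t then 1 else 0 := h.dual_family hB hx s
      simp only [map_sub, map_sum, map_smul, ← hb, key, smul_eq_mul, mul_ite, mul_one, mul_zero,
        Finset.sum_ite_eq, Finset.mem_univ, if_true, sub_self]
    | zero => simp
    | add y y' _ _ h1 h2 => rw [map_add, LinearMap.add_apply, h1, h2, add_zero]
    | smul c y _ h1 => rw [map_smul, LinearMap.smul_apply, h1, smul_zero]

theorem IsHyperbolic.blockSpan_nondegenerate :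
    ∀ z ∈ blockSpan x N w u, (∀ z' ∈ blockSpan x N w u, B z z' = 0) → z = 0 := by
  intro z hz hz0
  obtain ⟨c, rfl⟩ := (Submodule.mem_span_range_iff_exists_fun K).mp hz
  refine Finset.sum_eq_zero fun t _ => ?_
  have ht : Sum.elim (fun i : Fin N => (x ^ (N - 1 - i)) u)
      (fun i : Fin N => -(x ^ (N - 1 - i)) w) t ∈ blockSpan x N w u := by
    rcases t with i | i
    · exact pow_right_mem_blockSpan (h.pow_u ()) _
    · exact Submodule.neg_mem _ (pow_left_mem_blockSpan (h.pow_w ()) _)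
  have := hz0 _ ht
  simp only [map_sum, map_smul, LinearMap.sum_apply, LinearMap.smul_apply,
    h.dual_family hB hx] at this
  simp only [smul_eq_mul, mul_ite, mul_one, mul_zero, Finset.sum_ite_eq', Finset.mem_univ,
    if_true] at this
  rw [this, zero_smul]

theorem IsHyperbolic.finrank_blockSpan : finrank K (blockSpan x N w u) = 2 * N := by
  have hli : LinearIndependent K (Sum.elim (fun i : Fin N => (x ^ (i : ℕ)) w)
      (fun i : Fin N => (x ^ (i : ℕ)) u)) := by
    rw [Fintype.linearIndependent_iff]
    intro c hc t
    have := congrArg (fun z => B z (Sum.elim (fun i : Fin N => (x ^ (N - 1 - i)) u)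
      (fun i : Fin N => -(x ^ (N - 1 - i)) w) t)) hc
    simpa only [map_sum, map_smul, LinearMap.sum_apply, LinearMap.smul_apply, smul_eq_mul,
      h.dual_family hB hx, mul_ite, mul_one, mul_zero, Finset.sum_ite_eq', Finset.mem_univ,
      if_true, map_zero, LinearMap.zero_apply] using this
  rw [blockSpan, finrank_span_eq_card hli]
  simp [two_mul]

end Pair

/-- In a single hyperbolic block, every vector has the form `x ^ k w'` with `w'` a generator of
maximal height; so the generators can be chosen with the given vector in the chain of `w'`. -/
theorem exists_pair_of_mem_blockSpan [NeZero (2 : K)] (hB : B.IsAlt)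
    (hx : ∀ a b, B (x a) b = B a (x b)) {N : ℕ} {w u : W}
    (h : IsHyperbolicPair B x (N + 1) w u) {v : W} (hv : v ∈ blockSpan x (N + 1) w u) :
    ∃ a ≤ N + 1, ∃ w' ∈ blockSpan x (N + 1) w u, ∃ u' ∈ blockSpan x (N + 1) w u,
      IsHyperbolicPair B x (N + 1) w' u' ∧ v = (x ^ (N + 1 - a)) w' := by
  classical
  set H := blockSpan x (N + 1) w u with hH
  have hst : ∀ z ∈ H, x z ∈ H := blockSpan_stable (h.pow_w ()) (h.pow_u ())
  have hnil : ∀ z ∈ H, (x ^ (N + 1)) z = 0 := by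
    intro z hz
    have : H ≤ LinearMap.ker (x ^ (N + 1)) := by
      refine Submodule.span_le.mpr ?_
      rintro _ ⟨i | i, rfl⟩ <;>
        simp only [Sum.elim_inl, Sum.elim_inr, SetLike.mem_coe, LinearMap.mem_ker,
          ← Module.End.mul_apply, ← pow_add]
      · exact pow_eq_zero_of_le (by omega) (h.pow_w ())
      · exact pow_eq_zero_of_le (by omega) (h.pow_u ())
    exact this hz
  by_cases hv0 : v = 0
  · refine ⟨0, by omega, w, pow_left_mem_blockSpan (h.pow_w ()) 0, u,
      pow_right_mem_blockSpan (h.pow_u ()) 0, h, ?_⟩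
    rw [hv0, Nat.sub_zero, h.pow_w ()]
  -- `k` is the depth of `v` in the block
  let P : ℕ → Prop := fun k => ∃ z ∈ H, v = (x ^ k) z
  have hP0 : P 0 := ⟨v, hv, by simp⟩
  have hPle : ∀ k, P k → k ≤ N := by
    rintro k ⟨z, hz, rfl⟩
    by_contra hk
    exact hv0 (pow_eq_zero_of_le (by omega) (hnil z hz))
  set k := Nat.findGreatest P N
  obtain ⟨w', hw', hvk⟩ : P k := Nat.findGreatest_spec (P := P) (Nat.zero_le N) hP0
  have hkN : k ≤ N := Nat.findGreatest_le N
  have hmax : ¬ P (k + 1) := fun hk => by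
    have := Nat.le_findGreatest (hPle _ hk) hk
    change k + 1 ≤ k at this
    omega
  have hdec : ∀ z ∈ H, ∃ c d : K, ∃ z' ∈ H, z = c • w + d • u + x z' := by
    intro z hz
    induction hz using Submodule.span_induction with
    | mem z hz =>
      obtain ⟨⟨i, hi⟩ | ⟨i, hi⟩, rfl⟩ := hz
      · rcases i with _ | i
        · exact ⟨1, 0, 0, H.zero_mem, by simp⟩
        · exact ⟨0, 0, (x ^ i) w, pow_left_mem_blockSpan (h.pow_w ()) i, by
            simp [pow_succ', Module.End.mul_apply]⟩
      · rcases i with _ | i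
        · exact ⟨0, 1, 0, H.zero_mem, by simp⟩
        · exact ⟨0, 0, (x ^ i) u, pow_right_mem_blockSpan (h.pow_u ()) i, by
            simp [pow_succ', Module.End.mul_apply]⟩
    | zero => exact ⟨0, 0, 0, H.zero_mem, by simp⟩
    | add y y' _ _ h1 h2 =>
      obtain ⟨c, d, z, hz, rfl⟩ := h1
      obtain ⟨c', d', z', hz', rfl⟩ := h2
      exact ⟨c + c', d + d', z + z', H.add_mem hz hz', by rw [map_add]; module⟩
    | smul r y _ h1 =>
      obtain ⟨c, d, z, hz, rfl⟩ := h1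
      exact ⟨r * c, r * d, r • z, H.smul_mem r hz, by rw [map_smul]; module⟩
  have hw0 : (x ^ N) w' ≠ 0 := by
    intro h0
    obtain ⟨c, d, z, hz, rfl⟩ := hdec w' hw'
    have e : c • (x ^ N) w + d • (x ^ N) u = 0 := by
      rw [map_add, map_add, map_smul, map_smul, ← Module.End.mul_apply, ← pow_succ, hnil z hz,
        add_zero] at h0
      exact h0
    have hc : c = 0 := by
      simpa [h.uu () (), h.wu ()] using congrArg (fun t => B t u) e
    have huw : B ((x ^ N) u) w = -1 := by
      rw [bilin_pow hx, ← hB.neg_eq, h.wu (), if_pos rfl]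
    have hd : d = 0 := by
      simpa [h.ww () (), huw] using congrArg (fun t => B t w) e
    refine hmax ⟨z, hz, ?_⟩
    rw [hvk, hc, hd, zero_smul, zero_smul, zero_add, zero_add, pow_succ, Module.End.mul_apply]
  obtain ⟨u', hu', hwu⟩ := exists_dual_generator hx hst (h.blockSpan_nondegenerate hB hx) hw'
    (hnil w' hw') hw0
  exact ⟨N + 1 - k, by omega, w', hw', u', hu',
    isHyperbolicPair_of hB hx (hnil w' hw') (hnil u' hu') hwu, by
      rw [hvk]; congr 2; omega⟩

/-- Two hyperbolic systems in orthogonal `x`-stable subspaces combine into one. -/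
theorem IsHyperbolic.sum (hB : B.IsAlt) {ι κ : Type*} {l : ι → ℕ} {w u : ι → W}
    {l' : κ → ℕ} {w' u' : κ → W}
    (h : IsHyperbolic B x l w u) (h' : IsHyperbolic B x l' w' u') {M M' : Submodule K W}
    (hM : ∀ z ∈ M, x z ∈ M) (hM' : ∀ z ∈ M', x z ∈ M') (hMM' : ∀ z ∈ M, ∀ z' ∈ M', B z z' = 0)
    (hw : ∀ p, w p ∈ M) (hu : ∀ p, u p ∈ M) (hw' : ∀ p, w' p ∈ M') (hu' : ∀ p, u' p ∈ M') :
    IsHyperbolic B x (Sum.elim l l') (Sum.elim w w') (Sum.elim u u') := by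
  have hM'M : ∀ z ∈ M', ∀ z' ∈ M, B z z' = 0 := fun z hz z' hz' => by
    rw [← hB.neg_eq, hMM' z' hz' z hz, neg_zero]
  constructor
  · rintro (p | p); exacts [h.pow_w p, h'.pow_w p]
  · rintro (p | p); exacts [h.pow_u p, h'.pow_u p]
  · rintro (p | p) (q | q) i
    exacts [h.ww p q i, hMM' _ (pow_mem hM i (hw p)) _ (hw' q),
      hM'M _ (pow_mem hM' i (hw' p)) _ (hw q), h'.ww p q i]
  · rintro (p | p) (q | q) i
    exacts [h.uu p q i, hMM' _ (pow_mem hM i (hu p)) _ (hu' q),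
      hM'M _ (pow_mem hM' i (hu' p)) _ (hu q), h'.uu p q i]
  · rintro (p | p) (q | q) i hpq
    exacts [h.wu_ne p q i (fun e => hpq (e ▸ rfl)), hMM' _ (pow_mem hM i (hw p)) _ (hu' q),
      hM'M _ (pow_mem hM' i (hw' p)) _ (hu q), h'.wu_ne p q i (fun e => hpq (e ▸ rfl))]
  · rintro (p | p) i; exacts [h.wu p i, h'.wu p i]

variable [FiniteDimensional K W]

/-- An `x`-stable nondegenerate subspace splits into hyperbolic blocks, adapted to a given vector
`v`: the component of `v` in each block lies in the chain of the first generator. -/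
theorem exists_hyperbolic_adapted [NeZero (2 : K)] (hB : B.IsAlt)
    (hx : ∀ a b, B (x a) b = B a (x b)) (hnil : IsNilpotent x) (M : Submodule K W)
    (hM : ∀ z ∈ M, x z ∈ M) (hnd : ∀ z ∈ M, (∀ z' ∈ M, B z z' = 0) → z = 0) (v : W)
    (hv : v ∈ M) :
    ∃ (ι : Type) (_ : Fintype ι) (l a : ι → ℕ) (w u : ι → W),
      IsHyperbolic B x l w u ∧ (∀ p, w p ∈ M) ∧ (∀ p, u p ∈ M) ∧ (∀ p, a p ≤ l p) ∧
      2 * ∑ p, l p = finrank K M ∧ v = ∑ p, (x ^ (l p - a p)) (w p) := by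
  classical
  induction hd : finrank K M using Nat.strong_induction_on generalizing M v with
  | _ d ih =>
  by_cases hM0 : M = ⊥
  · subst hM0
    refine ⟨Empty, inferInstance, Empty.elim, Empty.elim, Empty.elim, Empty.elim, ?_,
      Empty.rec, Empty.rec, Empty.rec, ?_, ?_⟩
    · exact ⟨Empty.rec, Empty.rec, Empty.rec, Empty.rec, Empty.rec, Empty.rec⟩
    · simp [← hd]
    · simpa using hv
  have hex : ∃ N, ∀ z ∈ M, (x ^ N) z = 0 := by
    obtain ⟨N, hN⟩ := hnil
    exact ⟨N, fun z _ => by simp [hN]⟩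
  obtain ⟨N, hN, hNw⟩ : ∃ N, (∀ z ∈ M, (x ^ (N + 1)) z = 0) ∧ ∃ w ∈ M, (x ^ N) w ≠ 0 := by
    have h1 := Nat.find_spec hex
    rcases hf : Nat.find hex with _ | N
    · rw [hf] at h1
      exact absurd ((Submodule.eq_bot_iff M).mpr (by simpa using h1)) hM0
    · rw [hf] at h1
      have h2 := Nat.find_min hex (m := N) (by omega)
      push Not at h2
      exact ⟨N, h1, h2⟩
  obtain ⟨w, hw, hw0⟩ := hNw
  obtain ⟨u, hu, hwu⟩ := exists_dual_generator hx hM hnd hw (hN w hw) hw0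
  have hp : IsHyperbolicPair B x (N + 1) w u :=
    isHyperbolicPair_of hB hx (hN w hw) (hN u hu) hwu
  set H := blockSpan x (N + 1) w u with hH
  have hHM : H ≤ M := blockSpan_le hM hw hu
  have hHst : ∀ z ∈ H, x z ∈ H := blockSpan_stable (hp.pow_w ()) (hp.pow_u ())
  have hHfr : finrank K H = 2 * (N + 1) := hp.finrank_blockSpan hB hx
  -- the orthogonal complement of the block inside `M`
  let H' : Submodule K W :=
    { carrier := {z | z ∈ M ∧ ∀ y ∈ H, B y z = 0}
      zero_mem' := ⟨M.zero_mem, fun y _ => map_zero _⟩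
      add_mem' := fun h1 h2 => ⟨M.add_mem h1.1 h2.1, fun y hy => by
        rw [map_add, h1.2 y hy, h2.2 y hy, add_zero]⟩
      smul_mem' := fun c z h1 => ⟨M.smul_mem c h1.1, fun y hy => by
        rw [map_smul, h1.2 y hy, smul_zero]⟩ }
  have hH'M : H' ≤ M := fun z hz => hz.1
  have hH'st : ∀ z ∈ H', x z ∈ H' := fun z hz =>
    ⟨hM z hz.1, fun y hy => by rw [← hx]; exact hz.2 _ (hHst y hy)⟩
  have hproj : ∀ z ∈ M, ∃ z1 ∈ H, ∃ z2 ∈ H', z = z1 + z2 := by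
    intro z hz
    obtain ⟨z1, h1, h2⟩ := hp.exists_projection hB hx z
    exact ⟨z1, h1, z - z1, ⟨M.sub_mem hz (hHM h1), h2⟩, by abel⟩
  have hinf : H ⊓ H' = ⊥ := by
    rw [Submodule.eq_bot_iff]
    rintro z ⟨h1, h2⟩
    refine hp.blockSpan_nondegenerate hB hx z h1 fun y hy => ?_
    rw [← hB.neg_eq, h2.2 y hy, neg_zero]
  have hsup : H ⊔ H' = M := by
    refine le_antisymm (sup_le hHM hH'M) fun z hz => ?_
    obtain ⟨z1, h1, z2, h2, rfl⟩ := hproj z hz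
    exact Submodule.add_mem_sup h1 h2
  have hfr : finrank K M = 2 * (N + 1) + finrank K H' := by
    have := Submodule.finrank_sup_add_finrank_inf_eq H H'
    rwa [hsup, hinf, finrank_bot, add_zero, hHfr] at this
  have hH'nd : ∀ z ∈ H', (∀ z' ∈ H', B z z' = 0) → z = 0 := by
    intro z hz hz0
    refine hnd z hz.1 fun y hy => ?_
    obtain ⟨y1, h1, y2, h2, rfl⟩ := hproj y hy
    rw [map_add, hz0 y2 h2, ← hB.neg_eq, hz.2 y1 h1, neg_zero, add_zero]
  obtain ⟨v1, hv1, v2, hv2, rfl⟩ := hproj v hv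
  obtain ⟨a, ha, w', hw', u', hu', hp', rfl⟩ := exists_pair_of_mem_blockSpan hB hx hp hv1
  obtain ⟨ι, _, l2, a2, w2, u2, h2, hw2, hu2, ha2, hs2, rfl⟩ :=
    ih (finrank K H') (by omega) H' hH'st hH'nd v2 hv2 rfl
  refine ⟨Unit ⊕ ι, inferInstance, Sum.elim (fun _ => N + 1) l2, Sum.elim (fun _ => a) a2,
    Sum.elim (fun _ => w') w2, Sum.elim (fun _ => u') u2,
    hp'.sum hB h2 hHst hH'st (fun z hz z' hz' => hz'.2 z hz) (fun _ => hw') (fun _ => hu')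
      hw2 hu2, ?_, ?_, ?_, ?_, ?_⟩
  · rintro (p | p); exacts [hHM hw', hH'M (hw2 p)]
  · rintro (p | p); exacts [hHM hu', hH'M (hu2 p)]
  · rintro (p | p); exacts [ha, ha2 p]
  · rw [Fintype.sum_sum_type, ← hd, hfr, ← hs2]
    simp [mul_add]
  · rw [Fintype.sum_sum_type]
    simp

end HyperbolicSystems

/-! ### Reduction to marked partitions -/

section Reduction

variable {K W : Type*} [Field K] [AddCommGroup W] [Module K W]
  {B : LinearMap.BilinForm K W} {x : End K W}

/-- If the marks of the blocks `p` and `q` satisfy `a q ≤ a p` and `l p - a p ≤ l q - a q`, then a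
change of generators in these two blocks absorbs the `q`-th component of the vector
`∑ r, x ^ (l r - a r) (w r)` into the `p`-th one, which removes the mark of `q`. -/
theorem IsHyperbolic.exists_absorb {ι : Type*} [Fintype ι] [DecidableEq ι]
    (hx : ∀ a b, B (x a) b = B a (x b)) {l a : ι → ℕ} {w u : ι → W}
    (h : IsHyperbolic B x l w u) (ha : ∀ r, a r ≤ l r) {p q : ι} (hpq : p ≠ q)
    (h1 : a q ≤ a p) (h2 : l p - a p ≤ l q - a q) :
    ∃ w' u' : ι → W, IsHyperbolic B x l w' u' ∧
      ∑ r, (x ^ (l r - a r)) (w r) = ∑ r, (x ^ (l r - Function.update a q 0 r)) (w' r) := by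
  have hap := ha p
  have haq := ha q
  set c := (l q - a q) - (l p - a p) with hc
  set c' := a p - a q with hc'
  have hwu : ∀ r s i, B ((x ^ i) (w r)) (u s) = if r = s ∧ i + 1 = l r then 1 else 0 := by
    intro r s i
    rcases eq_or_ne r s with rfl | hrs
    · simp [h.wu]
    · simp [h.wu_ne r s i hrs, hrs]
  set w' : ι → W := fun r => w r + (if r = p then (1 : K) else 0) • (x ^ c) (w q) with hw'
  -- the correction of `u q` keeps it orthogonal to the new generator `w p + x ^ c (w q)`
  set u' : ι → W := fun r => u r - (if r = q then (1 : K) else 0) • (x ^ c') (u p) with hu'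
  refine ⟨w', u', ?_, ?_⟩
  · constructor
    · intro r
      by_cases hr : r = p
      · subst hr
        simp only [hw', if_true, one_smul, map_add, h.pow_w, ← Module.End.mul_apply, ← pow_add,
          zero_add]
        exact pow_eq_zero_of_le (by omega) (h.pow_w q)
      · simp [hw', hr, h.pow_w]
    · intro r
      by_cases hr : r = q
      · subst hr
        simp only [hu', if_true, one_smul, map_sub, h.pow_u, ← Module.End.mul_apply, ← pow_add,
          zero_sub, neg_eq_zero]
        exact pow_eq_zero_of_le (by omega) (h.pow_u p)
      · simp [hu', hr, h.pow_u]
    · intro r s i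
      simp only [hw', map_add, map_smul, LinearMap.add_apply, LinearMap.smul_apply,
        ← Module.End.mul_apply, ← pow_add, bilin_pow_pow hx, h.ww, smul_zero, add_zero]
    · intro r s i
      simp only [hu', map_sub, map_smul, LinearMap.sub_apply, LinearMap.smul_apply,
        ← Module.End.mul_apply, ← pow_add, bilin_pow_pow hx, h.uu, smul_zero, sub_zero]
    · intro r s i hrs
      simp only [hw', hu', map_add, map_sub, map_smul, LinearMap.add_apply, LinearMap.smul_apply,
        ← Module.End.mul_apply, ← pow_add, bilin_pow_pow hx, hwu, smul_eq_mul]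
      by_cases hr : r = p <;> by_cases hs : s = q
      · subst hr hs
        simp only [if_true, true_and, hpq, hpq.symm, false_and, if_false, mul_zero, add_zero,
          zero_add, one_mul]
        rw [sub_eq_zero]
        congr 1
        rw [eq_iff_iff]
        omega
      · simp [hr, hs, Ne.symm hs, hr ▸ hrs]
      · simp [hr, hs, show r ≠ q from hs ▸ hrs]
      · simp [hr, hs, hrs]
    · intro r i
      simp only [hw', hu', map_add, map_sub, map_smul, LinearMap.add_apply, LinearMap.smul_apply,
        ← Module.End.mul_apply, ← pow_add, bilin_pow_pow hx, hwu, smul_eq_mul]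
      by_cases hr : r = p
      · subst hr
        simp [hpq, hpq.symm]
      · simp [hr]
  · have e : ∀ r, (x ^ (l r - Function.update a q 0 r)) (w' r) =
        (x ^ (l r - a r)) (w r) +
          ((if r = p then (x ^ (l q - a q)) (w q) else 0) -
            (if r = q then (x ^ (l q - a q)) (w q) else 0)) := by
      intro r
      by_cases hr : r = p
      · subst hr
        simp only [hw', Function.update_of_ne hpq, if_true, one_smul, map_add,
          ← Module.End.mul_apply, ← pow_add, if_neg hpq, sub_zero]
        congr 3
        omega
      · by_cases hs : r = q
        · subst hs
          simp [hw', hr, h.pow_w]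
        · simp [hw', hr, hs]
    simp only [e, Finset.sum_add_distrib, Finset.sum_sub_distrib, Finset.sum_ite_eq',
      Finset.mem_univ, if_true, sub_self, add_zero]

/-- After finitely many absorptions no two marks are comparable: the marks form a chain that is
strictly decreasing together with the colengths `l p - a p`. -/
theorem IsHyperbolic.exists_incomparable {ι : Type*} [Fintype ι]
    (hx : ∀ a b, B (x a) b = B a (x b)) {l a : ι → ℕ} {w u : ι → W}
    (h : IsHyperbolic B x l w u) (ha : ∀ r, a r ≤ l r) :
    ∃ (a' : ι → ℕ) (w' u' : ι → W), IsHyperbolic B x l w' u' ∧ (∀ r, a' r ≤ l r) ∧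
      ∑ r, (x ^ (l r - a r)) (w r) = ∑ r, (x ^ (l r - a' r)) (w' r) ∧
      ∀ p q, p ≠ q → a' p ≠ 0 → a' q ≠ 0 → a' q ≤ a' p → l q - a' q < l p - a' p := by
  classical
  induction hk : (Finset.univ.filter fun r => a r ≠ 0).card using Nat.strong_induction_on
    generalizing a w u with
  | _ k ih =>
  by_cases hinc : ∀ p q, p ≠ q → a p ≠ 0 → a q ≠ 0 → a q ≤ a p → l q - a q < l p - a p
  · exact ⟨a, w, u, h, ha, rfl, hinc⟩
  push Not at hinc
  obtain ⟨p, q, hpq, hp, hq, h1, h2⟩ := hinc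
  obtain ⟨w1, u1, hh1, e1⟩ := h.exists_absorb hx ha hpq h1 h2
  have hlt : (Finset.univ.filter fun r => Function.update a q 0 r ≠ 0).card < k := by
    rw [← hk]
    refine Finset.card_lt_card ⟨fun r => ?_, fun hsub => ?_⟩
    · by_cases hr : r = q
      · simp [hr]
      · simp [hr]
    · have := hsub (x := q) (by simpa using hq)
      simp at this
  obtain ⟨a', w', u', hh', ha', e', hfin⟩ := ih _ hlt hh1 (fun r => by
    by_cases hr : r = q
    · simp [hr]
    · simpa [hr] using ha r) rfl
  exact ⟨a', w', u', hh', ha', e1.trans e', hfin⟩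

/-- Normal form of a pair (vector, self-adjoint nilpotent operator) on a space with a
nondegenerate alternating form. The blocks are numbered by `ℕ` in the order of decreasing length,
and among blocks of equal length the marked one comes last; those from `m` on are zero. -/
theorem exists_marked_hyperbolic [NeZero (2 : K)] [FiniteDimensional K W] (hB : B.IsAlt)
    (hnd : ∀ z, (∀ z', B z z' = 0) → z = 0)
    (hx : ∀ a b, B (x a) b = B a (x b)) (hnil : IsNilpotent x) (v : W) :
    ∃ (m : ℕ) (l a : ℕ → ℕ) (w u : ℕ → W), IsHyperbolic B x l w u ∧ (∀ p, m ≤ p → l p = 0) ∧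
      Antitone l ∧ (∀ p, a p ≤ l p) ∧ 2 * ∑ p ∈ Finset.range m, l p = finrank K W ∧
      v = ∑ p ∈ Finset.range m, (x ^ (l p - a p)) (w p) ∧
      (∀ p, l (p + 1) = l p → a p = 0) ∧
      ∀ p q, p < q → a p ≠ 0 → a q ≠ 0 → a q < a p ∧ l q - a q < l p - a p := by
  obtain ⟨ι, _, l, a, w, u, h, -, -, ha, hs, hv⟩ := exists_hyperbolic_adapted hB hx hnil ⊤
    (fun _ _ => trivial) (fun z _ hz => hnd z fun z' => hz z' trivial) v trivial
  obtain ⟨a', w', u', h', ha', e, hinc⟩ := h.exists_incomparable hx ha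
  rw [hv, e]
  clear hv e h ha w u a
  -- sorting by this key puts longer blocks first and, for equal lengths, unmarked blocks first
  let key : ι → ℕ := fun r => 2 * l r + if a' r = 0 then 1 else 0
  obtain ⟨m, σ, hσ⟩ : ∃ (m : ℕ) (σ : Fin m ≃ ι), Antitone (key ∘ σ) := by
    let τ := (Fintype.equivFin ι).symm
    refine ⟨Fintype.card ι, (Tuple.sort (OrderDual.toDual ∘ key ∘ τ)).trans τ, ?_⟩
    exact Tuple.monotone_sort (OrderDual.toDual ∘ key ∘ τ)
  have hkey : ∀ i j : Fin m, i ≤ j → key (σ j) ≤ key (σ i) := fun i j hij => hσ hij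
  have hl : ∀ i j : Fin m, i ≤ j → l (σ j) ≤ l (σ i) := fun i j hij => by
    have := hkey i j hij
    simp only [key] at this
    split_ifs at this <;> omega
  have hstrict : ∀ r s, r ≠ s → a' r ≠ 0 → a' s ≠ 0 → l s ≤ l r →
      a' s < a' r ∧ l s - a' s < l r - a' r := by
    intro r s hrs hr hs hls
    have h1 := ha' r
    have h2 := ha' s
    have h3 := hinc r s hrs hr hs
    have h4 := hinc s r hrs.symm hs hr
    omega
  let L : ℕ → ℕ := fun p => if hp : p < m then l (σ ⟨p, hp⟩) else 0
  let A : ℕ → ℕ := fun p => if hp : p < m then a' (σ ⟨p, hp⟩) else 0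
  let W' : ℕ → W := fun p => if hp : p < m then w' (σ ⟨p, hp⟩) else 0
  let U' : ℕ → W := fun p => if hp : p < m then u' (σ ⟨p, hp⟩) else 0
  have hA : ∀ p, A p ≠ 0 → p < m := fun p hp => by
    by_contra hpm
    exact hp (dif_neg hpm)
  refine ⟨m, L, A, W', U', ⟨?_, ?_, ?_, ?_, ?_, ?_⟩, ?_, ?_, ?_, ?_, ?_, ?_, ?_⟩
  · intro p
    by_cases hp : p < m <;> simp [L, W', hp, h'.pow_w]
  · intro p
    by_cases hp : p < m <;> simp [L, U', hp, h'.pow_u]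
  · intro p q i
    by_cases hp : p < m <;> by_cases hq : q < m <;> simp [W', hp, hq, h'.ww]
  · intro p q i
    by_cases hp : p < m <;> by_cases hq : q < m <;> simp [U', hp, hq, h'.uu]
  · intro p q i hpq
    by_cases hp : p < m <;> by_cases hq : q < m <;> simp only [W', U', hp, hq, dif_pos, dif_neg,
      not_false_eq_true, map_zero, LinearMap.zero_apply]
    exact h'.wu_ne _ _ _ (by simpa using hpq)
  · intro p i
    by_cases hp : p < m <;> simp [L, W', U', hp, h'.wu]
  · intro p hp
    simp [L, Nat.not_lt.mpr hp]
  · intro p q hpq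
    by_cases hq : q < m
    · simp only [L, hq, lt_of_le_of_lt hpq hq, dif_pos]
      exact hl _ _ hpq
    · simp [L, hq]
  · intro p
    by_cases hp : p < m <;> simp [L, A, hp, ha']
  · rw [← finrank_top K W, ← hs, ← Fin.sum_univ_eq_sum_range, ← σ.sum_comp]
    simp [L]
  · rw [← Fin.sum_univ_eq_sum_range (fun p => (x ^ (L p - A p)) (W' p)), ← σ.sum_comp]
    simp [L, A, W']
  · intro p hp
    by_contra hA0
    have hpm := hA p hA0
    have hAp := ha' (σ ⟨p, hpm⟩)
    simp only [A, L, hpm, dif_pos] at hA0 hp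
    by_cases hpm1 : p + 1 < m
    · simp only [hpm1, dif_pos] at hp
      have hk := hkey ⟨p, hpm⟩ ⟨p + 1, hpm1⟩ (by simp)
      have hA1 : a' (σ ⟨p + 1, hpm1⟩) ≠ 0 := by
        intro h0
        simp only [key, hp, h0, hA0, if_true, if_false] at hk
        omega
      have := hstrict (σ ⟨p, hpm⟩) (σ ⟨p + 1, hpm1⟩) (by simp) hA0 hA1 hp.le
      have := ha' (σ ⟨p + 1, hpm1⟩)
      omega
    · simp only [hpm1, dif_neg, not_false_eq_true] at hp
      omega
  · intro p q hpq hp0 hq0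
    have hp := hA p hp0
    have hq := hA q hq0
    simp only [A, L, hp, hq, dif_pos] at hp0 hq0 ⊢
    exact hstrict _ _ (by simpa using hpq.ne) hp0 hq0 (hl _ _ hpq.le)

end Reduction

/-! ### The symplectic form -/

section SymplecticForm

variable {n : ℕ}

/-- The symplectic form `∑ (aᵢ b_{n+i} - a_{n+i} bᵢ)` on `V₁`, for which `eᵢ = stdVec (inl i)` and
`fᵢ = stdVec (inr i)` satisfy `⟨eᵢ, fᵢ⟩ = 1`. It is minus the form with Gram matrix `Matrix.J`. -/
noncomputable def sform (n : ℕ) : LinearMap.BilinForm ℂ (V₁ n) :=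
  LinearMap.mk₂ ℂ (fun a b => ∑ i, (a (Sum.inl i) * b (Sum.inr i) - a (Sum.inr i) * b (Sum.inl i)))
    (fun a a' b => by
      rw [← Finset.sum_add_distrib]
      exact Finset.sum_congr rfl fun i _ => by simp only [Pi.add_apply]; ring)
    (fun c a b => by
      rw [smul_eq_mul, Finset.mul_sum]
      exact Finset.sum_congr rfl fun i _ => by simp only [Pi.smul_apply, smul_eq_mul]; ring)
    (fun a b b' => by
      rw [← Finset.sum_add_distrib]
      exact Finset.sum_congr rfl fun i _ => by simp only [Pi.add_apply]; ring)
    (fun c a b => by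
      rw [smul_eq_mul, Finset.mul_sum]
      exact Finset.sum_congr rfl fun i _ => by simp only [Pi.smul_apply, smul_eq_mul]; ring)

theorem sform_apply (a b : V₁ n) : sform n a b =
    ∑ i, (a (Sum.inl i) * b (Sum.inr i) - a (Sum.inr i) * b (Sum.inl i)) := rfl

theorem stdVec_apply (s t : Fin n ⊕ Fin n) : (stdVec s : V₁ n) t = if t = s then 1 else 0 :=
  Pi.single_apply s 1 t

theorem sform_isAlt : (sform n).IsAlt := fun a => by
  rw [sform_apply]
  exact Finset.sum_eq_zero fun i _ => by ring

theorem sform_swap (a b : V₁ n) : sform n a b = -sform n b a := (sform_isAlt.neg_eq b a).symm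

@[simp] theorem sform_inl_left (i : Fin n) (b : V₁ n) :
    sform n (stdVec (Sum.inl i)) b = b (Sum.inr i) := by
  simp [sform_apply, stdVec, Pi.single_apply]

@[simp] theorem sform_inr_left (i : Fin n) (b : V₁ n) :
    sform n (stdVec (Sum.inr i)) b = -b (Sum.inl i) := by
  simp [sform_apply, stdVec, Pi.single_apply]

theorem sform_nondegenerate (z : V₁ n) (hz : ∀ z', sform n z z' = 0) : z = 0 := by
  funext s
  rcases s with i | i
  · have := hz (stdVec (Sum.inr i))
    rw [sform_swap] at this
    simpa using this
  · have := hz (stdVec (Sum.inl i))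
    rw [sform_swap] at this
    simpa using this

theorem sform_eq_dotProduct (a b : V₁ n) : sform n a b = -(a ⬝ᵥ (Matrix.J (Fin n) ℂ *ᵥ b)) := by
  simp [sform_apply, Matrix.J, dotProduct, Matrix.mulVec, Fintype.sum_sum_type, Matrix.one_apply,
    Finset.sum_sub_distrib]
  ring

theorem eq_sum_stdVec (z : V₁ n) : z = ∑ s, z s • stdVec s := by
  funext b
  simp [stdVec, Finset.sum_apply, Pi.single_apply]

end SymplecticForm

/-! ### `∧² V₁` as a space of operators -/

section WedgeToEnd

variable {n : ℕ}

/-- The operator `z ↦ ⟨a, z⟩ b - ⟨b, z⟩ a`. -/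
noncomputable def pairEnd (a b : V₁ n) : End ℂ (V₁ n) :=
  (sform n a).smulRight b - (sform n b).smulRight a

theorem pairEnd_apply (a b z : V₁ n) : pairEnd a b z = sform n a z • b - sform n b z • a := rfl

/-- The `G`-equivariant embedding of `∧² V₁` into `End V₁` given by the symplectic form,
`a ∧ b ↦ (z ↦ ⟨a, z⟩ b - ⟨b, z⟩ a)`. Its image consists of self-adjoint operators, and `omega` is
sent to the identity. -/
noncomputable def wedgeEnd (n : ℕ) : Wedge n →ₗ[ℂ] End ℂ (V₁ n) :=
  exteriorPower.alternatingMapLinearEquiv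
    { toFun := fun m => pairEnd (m 0) (m 1)
      map_update_add' := by
        intro _ m i x y
        refine LinearMap.ext fun z => ?_
        fin_cases i
        · simp [pairEnd_apply]; module
        · simp [pairEnd_apply]; module
      map_update_smul' := by
        intro _ m i c x
        refine LinearMap.ext fun z => ?_
        fin_cases i
        · simp [pairEnd_apply]; module
        · simp [pairEnd_apply]; module
      map_eq_zero_of_eq' := by
        intro m i j hij hne
        have : m 0 = m 1 := by
          fin_cases i <;> fin_cases j <;> simp_all
        refine LinearMap.ext fun z => ?_
        simp [pairEnd_apply, this] }

@[simp] theorem wedgeEnd_wedge (a b : V₁ n) : wedgeEnd n (wedge a b) = pairEnd a b := by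
  rw [wedgeEnd, wedge, exteriorPower.alternatingMapLinearEquiv_apply_ιMulti]
  rfl

theorem span_wedge : Submodule.span ℂ {y : Wedge n | ∃ a b, y = wedge a b} = ⊤ := by
  rw [eq_top_iff, ← exteriorPower.ιMulti_span ℂ 2 (V₁ n)]
  refine Submodule.span_mono ?_
  rintro _ ⟨m, rfl⟩
  refine ⟨m 0, m 1, ?_⟩
  rw [wedge]
  congr 1
  funext i
  fin_cases i <;> rfl

theorem wedge_induction {p : Wedge n → Prop} (h : ∀ a b, p (wedge a b))
    (hadd : ∀ y y', p y → p y' → p (y + y')) (hsmul : ∀ (c : ℂ) y, p y → p (c • y)) (y : Wedge n) :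
    p y := by
  have hy : y ∈ Submodule.span ℂ {y : Wedge n | ∃ a b, y = wedge a b} := by
    rw [span_wedge]; trivial
  induction hy using Submodule.span_induction with
  | mem y hy => obtain ⟨a, b, rfl⟩ := hy; exact h a b
  | zero => simpa using hsmul 0 _ (h 0 0)
  | add y y' _ _ h1 h2 => exact hadd _ _ h1 h2
  | smul c y _ h1 => exact hsmul c y h1

theorem span_wedge_stdVec :
    Submodule.span ℂ {y : Wedge n | ∃ s t, y = wedge (stdVec s) (stdVec t)} = ⊤ := by
  rw [eq_top_iff]
  intro y _
  induction y using wedge_induction with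
  | h a b =>
    change wedgeBilin n a b ∈ _
    rw [eq_sum_stdVec a, eq_sum_stdVec b]
    simp only [map_sum, LinearMap.sum_apply, map_smul, LinearMap.smul_apply]
    exact Submodule.sum_mem _ fun s _ => Submodule.smul_mem _ _ (Submodule.sum_mem _ fun t _ =>
      Submodule.smul_mem _ _ (Submodule.subset_span ⟨t, s, rfl⟩))
  | hadd y y' h1 h2 => exact Submodule.add_mem _ (h1 trivial) (h2 trivial)
  | hsmul c y h1 => exact Submodule.smul_mem _ _ (h1 trivial)

theorem wedgeEnd_selfAdjoint (y : Wedge n) (z z' : V₁ n) :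
    sform n (wedgeEnd n y z) z' = sform n z (wedgeEnd n y z') := by
  induction y using wedge_induction with
  | h a b =>
    simp only [wedgeEnd_wedge, pairEnd_apply, map_sub, map_smul, LinearMap.sub_apply,
      LinearMap.smul_apply, smul_eq_mul]
    rw [sform_swap z a, sform_swap z b]
    ring
  | hadd y y' h1 h2 => simp [h1, h2]
  | hsmul c y h1 => simp [h1]

/-- A left inverse of `wedgeEnd`, up to the factor `-2`. -/
noncomputable def endWedge (n : ℕ) : End ℂ (V₁ n) →ₗ[ℂ] Wedge n :=
  ∑ i : Fin n, ((wedgeBilin n (stdVec (Sum.inr i)) ∘ₗ LinearMap.applyₗ (stdVec (Sum.inl i))) -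
    (wedgeBilin n (stdVec (Sum.inl i)) ∘ₗ LinearMap.applyₗ (stdVec (Sum.inr i))))

theorem endWedge_wedgeEnd (y : Wedge n) : endWedge n (wedgeEnd n y) = (-2 : ℂ) • y := by
  induction y using wedge_induction with
  | h a b =>
    have key : ∀ a b : V₁ n, ∑ i : Fin n, (wedgeBilin n (stdVec (Sum.inr i))
        (sform n a (stdVec (Sum.inl i)) • b) -
        wedgeBilin n (stdVec (Sum.inl i)) (sform n a (stdVec (Sum.inr i)) • b)) =
        -wedgeBilin n a b := by
      intro a b
      conv_rhs => rw [eq_sum_stdVec a]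
      rw [map_sum, LinearMap.sum_apply, Fintype.sum_sum_type, ← Finset.sum_add_distrib,
        ← Finset.sum_neg_distrib]
      refine Finset.sum_congr rfl fun i _ => ?_
      rw [sform_swap a, sform_swap a]
      simp only [sform_inl_left, sform_inr_left, map_smul, LinearMap.smul_apply]
      module
    have h1 := key a b
    have h2 := key b a
    rw [show wedgeBilin n b a = -wedgeBilin n a b from wedge_swap a b] at h2
    have h3 : endWedge n (wedgeEnd n (wedge a b)) = -wedgeBilin n a b - - -wedgeBilin n a b := by
      rw [← h2, ← h1, ← Finset.sum_sub_distrib]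
      simp only [endWedge, LinearMap.sum_apply, LinearMap.sub_apply, LinearMap.comp_apply,
        LinearMap.applyₗ_apply_apply, wedgeEnd_wedge, pairEnd_apply, map_sub]
      exact Finset.sum_congr rfl fun i _ => by abel
    rw [h3]
    change _ = (-2 : ℂ) • wedgeBilin n a b
    module
  | hadd y y' h1 h2 => rw [map_add, map_add, h1, h2, smul_add]
  | hsmul c y h1 => rw [map_smul, map_smul, h1, smul_comm]

theorem wedgeEnd_injective : Function.Injective (wedgeEnd n) := by
  intro y y' h
  have := congrArg (endWedge n) h
  rw [endWedge_wedgeEnd, endWedge_wedgeEnd] at this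
  exact smul_right_injective _ (by norm_num : (-2 : ℂ) ≠ 0) this

theorem wedgeEnd_omega (z : V₁ n) : wedgeEnd n (omega n) z = z := by
  have h : ∀ s, wedgeEnd n (omega n) (stdVec s) = stdVec s := by
    intro s
    simp only [omega, map_sum, wedgeEnd_wedge, LinearMap.sum_apply, pairEnd_apply, sform_inl_left,
      sform_inr_left]
    rcases s with j | j <;> simp [stdVec, Pi.single_apply, ite_smul]
  conv_rhs => rw [eq_sum_stdVec z]
  conv_lhs => rw [eq_sum_stdVec z, map_sum]
  exact Finset.sum_congr rfl fun s _ => by rw [map_smul, h]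

end WedgeToEnd

/-! ### The grading of `𝕍⁺` and nilpotency -/

section Grading

variable {n : ℕ}

/-- The degree of a standard basis vector under the cocharacter `ρ = (n, n - 1, …, 1)`, which is
positive on every positive root. -/
def deg : Fin n ⊕ Fin n → ℤ
  | Sum.inl i => n - i
  | Sum.inr i => -(n - i)

/-- The value at `2` of the cocharacter `(n, n - 1, …, 1)`. -/
noncomputable def rhoTorus (n : ℕ) : Fin n → ℂˣ := fun i => Units.mk0 2 two_ne_zero ^ ((n : ℤ) - i)

theorem torus_smul_stdVec (t : Fin n → ℂˣ) (s : Fin n ⊕ Fin n) :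
    torus t • (stdVec s : V₁ n) =
      Sum.elim (fun i => (t i : ℂ)) (fun i => ((t i)⁻¹ : ℂˣ)) s • stdVec s := by
  change Matrix.mulVec (Matrix.diagonal _) (Pi.single s 1) = _
  rw [Matrix.diagonal_mulVec_single]
  funext b
  simp [stdVec, Pi.single_apply]

theorem rhoTorus_smul_stdVec (s : Fin n ⊕ Fin n) :
    torus (rhoTorus n) • (stdVec s : V₁ n) = ((2 : ℂ) ^ deg s) • stdVec s := by
  rw [torus_smul_stdVec]
  congr 1
  rcases s with i | i
  · simp [rhoTorus, deg]
  · simp only [rhoTorus, deg, Sum.elim_inr, ← zpow_neg]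
    simp

theorem smul_mk_wedge (g : G n) (a b : V₁ n) :
    g • (Submodule.Quotient.mk (wedge a b) : V₂ n) =
      Submodule.Quotient.mk (wedge (g • a) (g • b)) := by
  rw [← wedgeMap_wedge]
  rfl

theorem wedge_smul_smul (c d : ℂ) (a b : V₁ n) :
    wedge (c • a) (d • b) = (c * d) • wedge a b := by
  change wedgeBilin n (c • a) (d • b) = (c * d) • wedgeBilin n a b
  rw [map_smul, map_smul, LinearMap.smul_apply, smul_smul, mul_comm d c]

/-- Pairing of a weight with the cocharacter `(n, n - 1, …, 1)`. -/
def rhoPairing {n : ℕ} : (Fin n → ℚ) →ₗ[ℚ] ℚ :=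
  ∑ i : Fin n, ((n : ℚ) - i) • LinearMap.proj i

theorem rhoPairing_apply (z : Fin n → ℚ) : rhoPairing z = ∑ i : Fin n, ((n : ℚ) - i) * z i := by
  simp [rhoPairing]

theorem rhoPairing_eps {m : ℕ} (h1 : 1 ≤ m) (hm : m ≤ n) :
    rhoPairing (toRat (eps n m)) = n + 1 - m := by
  rw [rhoPairing_apply, Finset.sum_eq_single ⟨m - 1, by omega⟩]
  · simp [toRat, eps, Nat.sub_add_cancel h1]
    rw [Nat.cast_sub h1]
    push_cast
    ring
  · intro i _ hi
    have : (i : ℕ) + 1 ≠ m := fun h => hi (Fin.ext (by simp; omega))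
    simp [toRat, eps, this]
  · simp

theorem toRat_add (l l' : Weight n) : toRat (l + l') = toRat l + toRat l' := by
  funext i; simp [toRat]

theorem toRat_sub (l l' : Weight n) : toRat (l - l') = toRat l - toRat l' := by
  funext i; simp [toRat]

theorem toRat_two_nsmul (l : Weight n) : toRat (2 • l) = (2 : ℚ) • toRat l := by
  funext i; simp [toRat]

theorem rhoPairing_posRoots_pos {r : Weight n} (hr : r ∈ posRoots n) :
    0 < rhoPairing (toRat r) := by
  rcases hr with ⟨i, j, hi, hij, hj, rfl | rfl⟩ | ⟨i, hi, hin, rfl⟩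
  · rw [toRat_add, map_add, rhoPairing_eps hi (by omega), rhoPairing_eps (by omega) hj]
    have : (i : ℚ) ≤ n := by exact_mod_cast (by omega : i ≤ n)
    have : (j : ℚ) ≤ n := by exact_mod_cast hj
    linarith
  · rw [toRat_sub, map_sub, rhoPairing_eps hi (by omega), rhoPairing_eps (by omega) hj]
    have : (i : ℚ) < j := by exact_mod_cast hij
    linarith
  · rw [toRat_two_nsmul, map_smul, rhoPairing_eps hi hin]
    have : (i : ℚ) ≤ n := by exact_mod_cast hin
    simp only [smul_eq_mul]
    linarith

theorem rhoPairing_posWeights_pos {l : Weight n} (hl : l ∈ posWeights n) :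
    0 < ∑ i : Fin n, ((n : ℤ) - i) * l i := by
  obtain ⟨h0, hl⟩ := hl
  have key : ∀ z ∈ Submodule.span ℚ≥0 (toRat '' posRoots n), z = 0 ∨ 0 < rhoPairing z := by
    intro z hz
    induction hz using Submodule.span_induction with
    | mem z hz =>
      obtain ⟨r, hr, rfl⟩ := hz
      exact Or.inr (rhoPairing_posRoots_pos hr)
    | zero => exact Or.inl rfl
    | add y z _ _ h1 h2 =>
      rcases h1 with rfl | h1
      · simpa using h2
      · rcases h2 with rfl | h2
        · simpa using Or.inr h1
        · exact Or.inr (by rw [map_add]; exact add_pos h1 h2)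
    | smul c z _ h1 =>
      rcases eq_or_ne c 0 with rfl | hc
      · left; simp
      · rcases h1 with rfl | h1
        · left; simp
        · right
          have e : c • z = (c : ℚ) • z := rfl
          rw [e, map_smul, smul_eq_mul]
          exact mul_pos (by exact_mod_cast pos_iff_ne_zero.mpr hc) h1
  have hl' : toRat l ≠ 0 := fun h => h0 (by
    funext i
    have := congrFun h i
    simpa [toRat] using this)
  have := (key _ hl).resolve_left hl'
  rw [rhoPairing_apply] at this
  simp only [toRat] at this
  exact_mod_cast this

/-- If `T` is diagonalizable on a spanning set of eigenvectors, an eigenvector of eigenvalue `μ` is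
a combination of those members of the set that have eigenvalue `μ`. -/
theorem mem_span_of_eigenvector {K W : Type*} [Field K] [AddCommGroup W] [Module K W] (T : End K W)
    {S : Set W} (hS : ∀ s ∈ S, ∃ ν : K, T s = ν • s) (hspan : Submodule.span K S = ⊤) {μ : K}
    {z : W} (hz : T z = μ • z) : z ∈ Submodule.span K {s ∈ S | T s = μ • s} := by
  have hdec : ∀ y : W, ∃ y1 ∈ Submodule.span K {s ∈ S | T s = μ • s},
      ∃ y2 ∈ ⨆ ν ≠ μ, T.eigenspace ν, y = y1 + y2 := by
    intro y
    have hy : y ∈ Submodule.span K S := hspan ▸ Submodule.mem_top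
    induction hy using Submodule.span_induction with
    | mem y hy =>
      obtain ⟨ν, hν⟩ := hS y hy
      by_cases h : ν = μ
      · exact ⟨y, Submodule.subset_span ⟨hy, h ▸ hν⟩, 0, Submodule.zero_mem _, by simp⟩
      · refine ⟨0, Submodule.zero_mem _, y, ?_, by simp⟩
        exact (le_iSup₂_of_le (f := fun ν (_ : ν ≠ μ) => T.eigenspace ν) ν h le_rfl)
          (End.mem_eigenspace_iff.mpr hν)
    | zero => exact ⟨0, Submodule.zero_mem _, 0, Submodule.zero_mem _, by simp⟩
    | add y y' _ _ h1 h2 =>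
      obtain ⟨a, ha, b, hb, rfl⟩ := h1
      obtain ⟨a', ha', b', hb', rfl⟩ := h2
      exact ⟨a + a', Submodule.add_mem _ ha ha', b + b', Submodule.add_mem _ hb hb', by abel⟩
    | smul c y _ h1 =>
      obtain ⟨a, ha, b, hb, rfl⟩ := h1
      exact ⟨c • a, Submodule.smul_mem _ _ ha, c • b, Submodule.smul_mem _ _ hb, smul_add _ _ _⟩
  obtain ⟨z1, h1, z2, h2, rfl⟩ := hdec z
  have hz1 : z1 ∈ T.eigenspace μ := by
    refine (Submodule.span_le (p := T.eigenspace μ)).mpr ?_ h1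
    exact fun s hs => End.mem_eigenspace_iff.mpr hs.2
  have hz2 : z2 ∈ T.eigenspace μ := by
    have := Submodule.sub_mem _ (End.mem_eigenspace_iff.mpr hz) hz1
    simpa using this
  have : z2 = 0 := (Submodule.disjoint_def.mp (T.eigenspaces_iSupIndep μ)) z2 hz2 h2
  rw [this, add_zero]
  exact h1

/-- The span of the `stdVec s ∧ stdVec t` of positive degree. -/
noncomputable def wedgePos (n : ℕ) : Submodule ℂ (Wedge n) :=
  Submodule.span ℂ {y | ∃ s t, 0 < deg s + deg t ∧ y = wedge (stdVec s) (stdVec t)}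

theorem weightSpace_snd_mem {l : Weight n} (hl : l ∈ posWeights n) {z : V n}
    (hz : z ∈ weightSpace l) : z.2 ∈ (wedgePos n).map (Submodule.mkQ _) := by
  have hpos := rhoPairing_posWeights_pos hl
  set m := ∑ i : Fin n, ((n : ℤ) - i) * l i with hm
  have hT : ∀ s t : Fin n ⊕ Fin n,
      actV₂ (torus (rhoTorus n)) (Submodule.Quotient.mk (wedge (stdVec s) (stdVec t))) =
        ((2 : ℂ) ^ (deg s + deg t)) • Submodule.Quotient.mk (wedge (stdVec s) (stdVec t)) := by
    intro s t
    change torus (rhoTorus n) • (Submodule.Quotient.mk (wedge (stdVec s) (stdVec t)) : V₂ n) = _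
    rw [smul_mk_wedge, rhoTorus_smul_stdVec, rhoTorus_smul_stdVec, wedge_smul_smul,
      zpow_add₀ two_ne_zero]
    rfl
  have hz2 : actV₂ (torus (rhoTorus n)) z.2 = ((2 : ℂ) ^ m) • z.2 := by
    have h1 := congrArg Prod.snd (hz (rhoTorus n))
    have h2 : ((∏ i, rhoTorus n i ^ l i : ℂˣ) : ℂ) = (2 : ℂ) ^ m := by
      have h3 : ∀ T : Finset (Fin n), ((∏ i ∈ T, rhoTorus n i ^ l i : ℂˣ) : ℂ) =
          (2 : ℂ) ^ (∑ i ∈ T, ((n : ℤ) - i) * l i) := by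
        intro T
        induction T using Finset.induction_on with
        | empty => simp
        | insert i T hi ih =>
          rw [Finset.prod_insert hi, Finset.sum_insert hi, Units.val_mul, ih,
            zpow_add₀ two_ne_zero, zpow_mul]
          simp [rhoTorus]
      exact h3 _
    rw [h2] at h1
    exact h1
  let S : Set (V₂ n) := {y | ∃ s t, y = Submodule.Quotient.mk (wedge (stdVec s) (stdVec t))}
  have hspan : Submodule.span ℂ S = ⊤ := by
    have : S = (Submodule.mkQ (Submodule.span ℂ {omega n})) ''
        {y : Wedge n | ∃ s t, y = wedge (stdVec s) (stdVec t)} := by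
      ext y
      constructor
      · rintro ⟨s, t, rfl⟩; exact ⟨_, ⟨s, t, rfl⟩, rfl⟩
      · rintro ⟨_, ⟨s, t, rfl⟩, rfl⟩; exact ⟨s, t, rfl⟩
    rw [this, ← Submodule.map_span, span_wedge_stdVec, Submodule.map_top, Submodule.range_mkQ]
  have hmem := mem_span_of_eigenvector (actV₂ (torus (rhoTorus n))) (S := S)
    (by rintro _ ⟨s, t, rfl⟩; exact ⟨_, hT s t⟩) hspan hz2
  refine (Submodule.span_le.mpr ?_) hmem
  rintro _ ⟨⟨s, t, rfl⟩, h⟩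
  by_cases h0 : (Submodule.Quotient.mk (wedge (stdVec s) (stdVec t)) : V₂ n) = 0
  · rw [h0]; exact Submodule.zero_mem _
  · rw [hT] at h
    have h3 := smul_left_injective ℂ h0 h
    have h5 : (2 : ℝ) ^ (deg s + deg t) = 2 ^ m :=
      Complex.ofReal_injective (by push_cast; exact h3)
    have h4 : deg s + deg t = m :=
      zpow_right_injective₀ (by norm_num : (0 : ℝ) < 2) (by norm_num) h5
    exact ⟨_, Submodule.subset_span ⟨s, t, by omega, rfl⟩, rfl⟩

theorem Vplus_snd_mem {z : V n} (hz : z ∈ Vplus n) :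
    ∃ y ∈ wedgePos n, z.2 = Submodule.Quotient.mk y := by
  have h : Vplus n ≤ ((wedgePos n).map (Submodule.mkQ (Submodule.span ℂ {omega n}))).comap
      (LinearMap.snd ℂ (V₁ n) (V₂ n)) :=
    iSup₂_le fun l hl z hz => weightSpace_snd_mem hl hz
  obtain ⟨y, hy, e⟩ := h hz
  exact ⟨y, hy, e.symm⟩

/-- The span of the standard basis vectors of degree at least `k`. -/
noncomputable def degGE (n : ℕ) (k : ℤ) : Submodule ℂ (V₁ n) :=
  Submodule.span ℂ {z | ∃ s, k ≤ deg s ∧ z = stdVec s}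

theorem wedgeEnd_degGE {y : Wedge n} (hy : y ∈ wedgePos n) (k : ℤ) :
    ∀ z ∈ degGE n k, wedgeEnd n y z ∈ degGE n (k + 1) := by
  induction hy using Submodule.span_induction with
  | mem y hy =>
    obtain ⟨s, t, hst, rfl⟩ := hy
    have hform : ∀ s r : Fin n ⊕ Fin n, sform n (stdVec s) (stdVec r) ≠ 0 → deg s = -deg r := by
      rintro (i | i) (j | j) h <;> simp [stdVec_apply] at h <;> simp [deg, h]
    have : degGE n k ≤ (degGE n (k + 1)).comap (wedgeEnd n (wedge (stdVec s) (stdVec t))) := by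
      refine Submodule.span_le.mpr ?_
      rintro _ ⟨r, hr, rfl⟩
      rw [SetLike.mem_coe, Submodule.mem_comap, wedgeEnd_wedge, pairEnd_apply]
      refine Submodule.sub_mem _ ?_ ?_
      · by_cases h : sform n (stdVec s) (stdVec r) = 0
        · rw [h, zero_smul]; exact Submodule.zero_mem _
        · have := hform _ _ h
          exact Submodule.smul_mem _ _ (Submodule.subset_span ⟨t, by omega, rfl⟩)
      · by_cases h : sform n (stdVec t) (stdVec r) = 0
        · rw [h, zero_smul]; exact Submodule.zero_mem _
        · have := hform _ _ h
          exact Submodule.smul_mem _ _ (Submodule.subset_span ⟨s, by omega, rfl⟩)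
    exact this
  | zero => intro z _; simp
  | add y y' _ _ h1 h2 =>
    intro z hz
    rw [map_add]
    exact Submodule.add_mem _ (h1 z hz) (h2 z hz)
  | smul c y _ h1 =>
    intro z hz
    rw [map_smul]
    exact Submodule.smul_mem _ _ (h1 z hz)

/-- Elements of positive degree act nilpotently, since they raise the degree. -/
theorem wedgeEnd_isNilpotent {y : Wedge n} (hy : y ∈ wedgePos n) : IsNilpotent (wedgeEnd n y) := by
  have hraise : ∀ (j : ℕ) (k : ℤ), ∀ z ∈ degGE n k, ((wedgeEnd n y) ^ j) z ∈ degGE n (k + j) := by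
    intro j
    induction j with
    | zero => intro k z hz; simpa using hz
    | succ j ih =>
      intro k z hz
      rw [pow_succ', Module.End.mul_apply]
      have := wedgeEnd_degGE hy _ _ (ih k z hz)
      rwa [add_assoc] at this
  have hdeg : ∀ s : Fin n ⊕ Fin n, -(n : ℤ) ≤ deg s ∧ deg s ≤ n := by
    rintro (i | i) <;> simp only [deg] <;> omega
  refine ⟨2 * n + 1, LinearMap.ext fun z => ?_⟩
  have hz : z ∈ degGE n (-n) := by
    rw [eq_sum_stdVec z]
    exact Submodule.sum_mem _ fun s _ => Submodule.smul_mem _ _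
      (Submodule.subset_span ⟨s, (hdeg s).1, rfl⟩)
  have h := hraise (2 * n + 1) _ z hz
  have hbot : degGE n (-(n : ℤ) + ((2 * n + 1 : ℕ) : ℤ)) = ⊥ := by
    rw [degGE, Submodule.span_eq_bot]
    rintro _ ⟨s, hs, rfl⟩
    have := (hdeg s).2
    push_cast at hs
    omega
  rw [hbot] at h
  simpa using h

end Grading

/-! ### Weight vectors -/

section WeightVectors

variable {n : ℕ} {v : Weight n → V n}

theorem IsWeightBasis.exists_eq_smul (hv : IsWeightBasis v) {l : Weight n} (hl : l ≠ 0) {z : V n}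
    (hz : z ∈ weightSpace l) (hz0 : z ≠ 0) : ∃ c : ℂ, c ≠ 0 ∧ v l = c • z := by
  rw [hv l hl] at hz
  obtain ⟨c, rfl⟩ := Submodule.mem_span_singleton.mp hz
  have hc : c ≠ 0 := fun h => hz0 (by rw [h, zero_smul])
  exact ⟨c⁻¹, inv_ne_zero hc, by rw [smul_smul, inv_mul_cancel₀ hc, one_smul]⟩

theorem stdVec_ne_zero (s : Fin n ⊕ Fin n) : stdVec s ≠ 0 := fun h => by
  have := congrFun h s
  simp [stdVec] at this

theorem prod_zpow_eps (t : Fin n → ℂˣ) (i : Fin n) : ∏ j, t j ^ eps n (i + 1) j = t i := by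
  rw [Finset.prod_eq_single i]
  · simp [eps]
  · intro j _ hj
    have : (j : ℕ) ≠ i := fun h => hj (Fin.ext h)
    simp [eps, this]
  · simp

theorem IsWeightBasis.exists_eps (hv : IsWeightBasis v) : ∃ c : ℕ → ℂ, (∀ i, c i ≠ 0) ∧
    ∀ i : Fin n, v (eps n (i + 1)) = (c i • stdVec (Sum.inl i), 0) := by
  have h : ∀ i : Fin n, ∃ c : ℂ, c ≠ 0 ∧ v (eps n (i + 1)) = c • (stdVec (Sum.inl i), 0) := by
    intro i
    refine hv.exists_eq_smul (eps_mem_posWeights (by omega) (by omega)).1 (fun t => ?_) ?_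
    · rw [prod_zpow_eps, Prod.smul_mk, torus_smul_stdVec, smul_zero, Prod.smul_mk, smul_zero]
      rfl
    · exact fun h => stdVec_ne_zero _ (congrArg Prod.fst h)
  choose c hc0 hc using h
  refine ⟨fun i => if h : i < n then c ⟨i, h⟩ else 1, fun i => ?_, fun i => ?_⟩
  · by_cases h : i < n <;> simp [h, hc0]
  · simp [hc]

theorem mk_wedge_ne_zero {i j : Fin n} (hij : i ≠ j) :
    (Submodule.Quotient.mk (wedge (stdVec (Sum.inl i)) (stdVec (Sum.inr j))) : V₂ n) ≠ 0 := by
  intro h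
  rw [Submodule.Quotient.mk_eq_zero, Submodule.mem_span_singleton] at h
  obtain ⟨c, hc⟩ := h
  -- a scalar operator cannot send `fᵢ` to `fⱼ`
  have h1 : ∀ z, c • z = pairEnd (stdVec (Sum.inl i)) (stdVec (Sum.inr j)) z := by
    intro z
    rw [← wedgeEnd_wedge, ← hc, map_smul, LinearMap.smul_apply, wedgeEnd_omega]
  have h2 := congrFun (h1 (stdVec (Sum.inr i))) (Sum.inr j)
  simp [pairEnd_apply, stdVec_apply, hij.symm] at h2

theorem IsWeightBasis.exists_alpha (hv : IsWeightBasis v) : ∃ d : ℕ → ℂ, (∀ i, d i ≠ 0) ∧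
    ∀ (i : ℕ) (hi : i + 1 < n), v (alpha n (i + 1)) = (0, d i • Submodule.Quotient.mk
      (wedge (stdVec (Sum.inl ⟨i, by omega⟩)) (stdVec (Sum.inr ⟨i + 1, hi⟩)))) := by
  have h : ∀ (i : ℕ) (hi : i + 1 < n), ∃ d : ℂ, d ≠ 0 ∧ v (alpha n (i + 1)) =
      d • (0, Submodule.Quotient.mk
        (wedge (stdVec (Sum.inl ⟨i, by omega⟩)) (stdVec (Sum.inr ⟨i + 1, hi⟩)))) := by
    intro i hi
    refine hv.exists_eq_smul (alpha_mem_posWeights (by omega) (by omega)).1 (fun t => ?_) ?_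
    · have e : ∏ j, t j ^ alpha n (i + 1) j = t ⟨i, by omega⟩ * (t ⟨i + 1, hi⟩)⁻¹ := by
        rw [← prod_zpow_eps t ⟨i, by omega⟩, ← prod_zpow_eps t ⟨i + 1, hi⟩,
          ← Finset.prod_inv_distrib, ← Finset.prod_mul_distrib]
        exact Finset.prod_congr rfl fun j _ => by simp [alpha, zpow_sub]
      rw [e, Prod.smul_mk, smul_mk_wedge, torus_smul_stdVec, torus_smul_stdVec, wedge_smul_smul,
        smul_zero, Prod.smul_mk, smul_zero]
      rfl
    · exact fun h => mk_wedge_ne_zero (by simp) (congrArg Prod.snd h)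
  choose d hd0 hd using h
  refine ⟨fun i => if h : i + 1 < n then d i h else 1, fun i => ?_, fun i hi => ?_⟩
  · by_cases h : i + 1 < n <;> simp [h, hd0]
  · simp [hd i hi, hi]

end WeightVectors

/-! ### Conjugation to a normal form -/

section NormalForms

variable {n : ℕ}

theorem exists_symplectic_of_columns (col : Fin n ⊕ Fin n → V₁ n)
    (h : ∀ s t, sform n (col s) (col t) = sform n (stdVec s) (stdVec t)) :
    ∃ g : G n, ∀ s, g • (stdVec s : V₁ n) = col s := by
  have hcol : ∀ s, (Matrix.of fun r c => col c r).mulVec (stdVec s) = col s := fun s => by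
    funext r
    simp [stdVec]
  refine ⟨⟨Matrix.of fun r c => col c r, ?_⟩, hcol⟩
  rw [SymplecticGroup.mem_iff']
  ext s t
  have h1 := h s t
  rw [sform_eq_dotProduct, sform_eq_dotProduct, neg_inj] at h1
  have h2 : stdVec s ⬝ᵥ (Matrix.J (Fin n) ℂ).mulVec (stdVec t) = Matrix.J (Fin n) ℂ s t := by
    simp [stdVec]
  rw [h2] at h1
  rw [← h1, Matrix.mul_assoc]
  simp only [Matrix.mul_apply, dotProduct, Matrix.mulVec, Matrix.transpose_apply, Matrix.of_apply]

/-- On the span of the chains, `x` is the operator attached to the bivector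
`∑ (x ^ (l p - 1 - k) (w p)) ∧ (x ^ (k + 1) (u p))`; this is where the root vectors of weight
`εᵢ - εᵢ₊₁` in the normal form come from. -/
theorem IsHyperbolic.sum_pairEnd_apply {x : End ℂ (V₁ n)}
    (hx : ∀ a b, sform n (x a) b = sform n a (x b)) {l : ℕ → ℕ} {w u : ℕ → V₁ n}
    (h : IsHyperbolic (sform n) x l w u) {m q : ℕ} (hq : q < m) (i : ℕ) :
    (∑ p ∈ Finset.range m, ∑ k ∈ Finset.range (l p - 1),
        pairEnd ((x ^ (l p - 1 - k)) (w p)) ((x ^ (k + 1)) (u p))) ((x ^ i) (w q)) =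
        x ((x ^ i) (w q)) ∧
      (∑ p ∈ Finset.range m, ∑ k ∈ Finset.range (l p - 1),
        pairEnd ((x ^ (l p - 1 - k)) (w p)) ((x ^ (k + 1)) (u p))) ((x ^ i) (u q)) =
        x ((x ^ i) (u q)) := by
  have hwu : ∀ p r j, sform n ((x ^ j) (w p)) (u r) = if p = r ∧ j + 1 = l p then 1 else 0 := by
    intro p r j
    rcases eq_or_ne p r with rfl | hpr
    · simp [h.wu]
    · simp [h.wu_ne p r j hpr, hpr]
  have huw : ∀ p r j, sform n ((x ^ j) (u p)) (w r) =
      -(if r = p ∧ j + 1 = l r then 1 else 0) := by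
    intro p r j
    rw [bilin_pow hx, sform_swap, hwu]
  simp only [LinearMap.sum_apply, pairEnd_apply, bilin_pow_pow hx, h.ww, h.uu, hwu, huw, zero_smul,
    zero_sub, sub_zero]
  rw [← Module.End.mul_apply, ← Module.End.mul_apply, ← pow_succ']
  constructor
  · rw [Finset.sum_eq_single_of_mem q (Finset.mem_range.mpr hq)]
    · rcases Nat.lt_or_ge (i + 1) (l q) with hi | hi
      · rw [Finset.sum_eq_single_of_mem (l q - 1 - (i + 1)) (Finset.mem_range.mpr (by omega))]
        · rw [if_pos ⟨rfl, by omega⟩, neg_smul, neg_neg, one_smul]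
          congr 2
          omega
        · intro k _ hk
          rw [if_neg (by omega), neg_zero, zero_smul, neg_zero]
      · rw [pow_eq_zero_of_le hi (h.pow_w q)]
        refine Finset.sum_eq_zero fun k _ => ?_
        rw [if_neg (by omega), neg_zero, zero_smul, neg_zero]
    · intro p _ hp
      refine Finset.sum_eq_zero fun k _ => ?_
      rw [if_neg (fun hh => hp hh.1.symm), neg_zero, zero_smul, neg_zero]
  · rw [Finset.sum_eq_single_of_mem q (Finset.mem_range.mpr hq)]
    · rcases Nat.lt_or_ge (i + 1) (l q) with hi | hi
      · rw [Finset.sum_eq_single_of_mem i (Finset.mem_range.mpr (by omega))]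
        · rw [if_pos ⟨rfl, by omega⟩, one_smul]
        · intro k hk hki
          rw [Finset.mem_range] at hk
          rw [if_neg (by omega), zero_smul]
      · rw [pow_eq_zero_of_le hi (h.pow_u q)]
        refine Finset.sum_eq_zero fun k hk => ?_
        rw [Finset.mem_range] at hk
        rw [if_neg (by omega), zero_smul]
    · intro p _ hp
      refine Finset.sum_eq_zero fun k _ => ?_
      rw [if_neg (fun hh => hp hh.1), zero_smul]

/-- Division with remainder by the consecutive intervals of lengths `l 0, l 1, …`: existence. -/
theorem exists_block_index (l : ℕ → ℕ) {m i : ℕ} (hi : i < ∑ q ∈ Finset.range m, l q) :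
    ∃ p k, p < m ∧ k < l p ∧ i = ∑ q ∈ Finset.range p, l q + k := by
  induction m with
  | zero => simp at hi
  | succ m ih =>
    rcases Nat.lt_or_ge i (∑ q ∈ Finset.range m, l q) with h | h
    · obtain ⟨p, k, hp, hk, e⟩ := ih h
      exact ⟨p, k, by omega, hk, e⟩
    · rw [Finset.sum_range_succ] at hi
      exact ⟨m, i - ∑ q ∈ Finset.range m, l q, by omega, by omega, by omega⟩

/-- Division with remainder by the consecutive intervals of lengths `l 0, l 1, …`: uniqueness. -/
theorem block_index_unique {l : ℕ → ℕ} {p q k j : ℕ} (hk : k < l p) (hj : j < l q)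
    (h : ∑ r ∈ Finset.range p, l r + k = ∑ r ∈ Finset.range q, l r + j) : p = q ∧ k = j := by
  have key : ∀ p q, p < q → ∑ r ∈ Finset.range p, l r + l p ≤ ∑ r ∈ Finset.range q, l r := by
    intro p q hpq
    rw [← Finset.sum_range_succ]
    exact Finset.sum_le_sum_of_subset (Finset.range_mono hpq)
  rcases lt_trichotomy p q with hpq | rfl | hpq
  · have := key p q hpq; omega
  · exact ⟨rfl, by omega⟩
  · have := key q p hpq; omega

/-- Every vector of `𝕍` whose second component lifts to a bivector acting nilpotently on `V₁` is
conjugate to a normal form. -/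
theorem exists_smul_normalForm {v : Weight n → V n} (hv : IsWeightBasis v) (z : V₁ n)
    (y : Wedge n) (hy : IsNilpotent (wedgeEnd n y)) :
    ∃ (mp : MarkedPartition n) (g : G n), g • normalForm v mp = (z, Submodule.Quotient.mk y) := by
  have hx := wedgeEnd_selfAdjoint y
  obtain ⟨m, l, a, w, u, h, hlm, hanti, hal, hsum, hz, heq, hlt⟩ :=
    exists_marked_hyperbolic sform_isAlt sform_nondegenerate hx hy z
  set x := wedgeEnd n y with hxdef
  have hsum' : ∑ p ∈ Finset.range m, l p = n := by
    simp at hsum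
    omega
  let mp : MarkedPartition n :=
    { part := Finsupp.onFinset (Finset.range m) l fun p hp => by
        rw [Finset.mem_range]
        by_contra hpm
        exact hp (hlm p (by omega))
      mark := a
      antitone_part := hanti
      sum_part := by
        rw [Finsupp.onFinset_sum _ (fun _ => rfl)]
        exact hsum'
      mark_le := hal
      mark_eq_zero := heq
      mark_lt := fun p q hpq hp hq => by
        have h1 := hlt p q hpq hp hq
        have h2 := hal p
        have h3 := hal q
        simp only [Finsupp.onFinset_apply]
        omega }
  have hpart : ∀ p, mp.part p = l p := fun _ => rfl
  have hmark : ∀ p, mp.mark p = a p := fun _ => rfl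
  let bef : ℕ → ℕ := fun p => ∑ q ∈ Finset.range p, l q
  have hble : ∀ p, bef p + l p ≤ n := mp.before_add_le
  obtain ⟨c, hc0, hc⟩ := hv.exists_eps
  obtain ⟨d, hd0, hd⟩ := hv.exists_alpha
  have hidx : ∀ i : Fin n, ∃ p k, p < m ∧ k < l p ∧ (i : ℕ) = bef p + k :=
    fun i => exists_block_index l (by rw [hsum']; exact i.2)
  choose P K hPm hKl hPK using hidx
  -- `r p` and the products of the `d j` rescale the chains so that all coefficients become `1`
  let D : ℕ → ℂ := fun i => ∏ j ∈ Finset.range i, d j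
  have hD0 : ∀ i, D i ≠ 0 := fun i => Finset.prod_ne_zero_iff.mpr fun j _ => hd0 j
  let r : ℕ → ℂ := fun p => (c (bef p + (a p - 1)) * D (bef p + (a p - 1)))⁻¹
  have hr0 : ∀ p, r p ≠ 0 := fun p => inv_ne_zero (mul_ne_zero (hc0 _) (hD0 _))
  let σ : ℕ → ℕ → ℂ := fun p k => D (bef p + k) * r p
  have hσ0 : ∀ p k, σ p k ≠ 0 := fun p k => mul_ne_zero (hD0 _) (hr0 _)
  obtain ⟨g, hg⟩ := exists_symplectic_of_columns
    (Sum.elim (fun i : Fin n => σ (P i) (K i) • (x ^ (l (P i) - 1 - K i)) (w (P i)))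
      (fun i : Fin n => (σ (P i) (K i))⁻¹ • (x ^ K i) (u (P i)))) (by
    have hwu : ∀ i j : Fin n, sform n (σ (P i) (K i) • (x ^ (l (P i) - 1 - K i)) (w (P i)))
        ((σ (P j) (K j))⁻¹ • (x ^ K j) (u (P j))) = if i = j then 1 else 0 := by
      intro i j
      rw [map_smul, map_smul, LinearMap.smul_apply, bilin_pow_pow hx]
      by_cases hp : P i = P j
      · have hi := hKl i
        have hj := hKl j
        rw [hp] at hi
        rw [hp, h.wu]
        by_cases hij : i = j
        · subst hij
          rw [if_pos (by omega), if_pos rfl]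
          simp [hσ0]
        · rw [if_neg hij, if_neg]
          · simp
          · intro hk
            refine hij (Fin.ext ?_)
            rw [hPK i, hPK j, hp]
            omega
      · rw [h.wu_ne _ _ _ hp, if_neg fun hij => hp (by rw [hij])]
        simp
    rintro (i | i) (j | j)
    · simp [bilin_pow_pow hx, h.ww, stdVec_apply]
    · rw [Sum.elim_inl, Sum.elim_inr, hwu]
      simp [stdVec_apply]
    · rw [Sum.elim_inl, Sum.elim_inr, sform_swap, hwu]
      simp [stdVec_apply, eq_comm]
    · simp [bilin_pow_pow hx, h.uu, stdVec_apply])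
  have hgE : ∀ p k (hk : k < l p) (hi : bef p + k < n),
      g • (stdVec (Sum.inl ⟨bef p + k, hi⟩) : V₁ n) =
        σ p k • (x ^ (l p - 1 - k)) (w p) := by
    intro p k hk hi
    obtain ⟨e1, e2⟩ := block_index_unique hk (hKl ⟨bef p + k, hi⟩) (hPK ⟨bef p + k, hi⟩)
    rw [hg, Sum.elim_inl, ← e1, ← e2]
  have hgF : ∀ p k (hk : k < l p) (hi : bef p + k < n),
      g • (stdVec (Sum.inr ⟨bef p + k, hi⟩) : V₁ n) = (σ p k)⁻¹ • (x ^ k) (u p) := by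
    intro p k hk hi
    obtain ⟨e1, e2⟩ := block_index_unique hk (hKl ⟨bef p + k, hi⟩) (hPK ⟨bef p + k, hi⟩)
    rw [hg, Sum.elim_inr, ← e1, ← e2]
  have hy' : y = ∑ p ∈ Finset.range m, ∑ k ∈ Finset.range (l p - 1),
      wedge ((x ^ (l p - 1 - k)) (w p)) ((x ^ (k + 1)) (u p)) := by
    apply wedgeEnd_injective
    simp only [map_sum, wedgeEnd_wedge]
    rw [← hxdef]
    have hcols : ∀ s, (∑ p ∈ Finset.range m, ∑ k ∈ Finset.range (l p - 1),
        pairEnd ((x ^ (l p - 1 - k)) (w p)) ((x ^ (k + 1)) (u p))) (g • (stdVec s : V₁ n)) =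
        x (g • (stdVec s : V₁ n)) := by
      rintro (i | i)
      · rw [hg, Sum.elim_inl, map_smul, map_smul, (h.sum_pairEnd_apply hx (hPm i) _).1]
      · rw [hg, Sum.elim_inr, map_smul, map_smul, (h.sum_pairEnd_apply hx (hPm i) _).2]
    refine LinearMap.ext fun t => ?_
    have ht : t = ∑ s, (g⁻¹ • t) s • (g • (stdVec s : V₁ n)) := by
      conv_lhs => rw [← smul_inv_smul g t, eq_sum_stdVec (g⁻¹ • t), Finset.smul_sum]
      exact Finset.sum_congr rfl fun s _ => smul_comm _ _ _
    rw [ht, map_sum, map_sum]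
    exact Finset.sum_congr rfl fun s _ => by
      rw [LinearMap.map_smul, LinearMap.map_smul, hcols]
  refine ⟨mp, g, ?_⟩
  have hblock : ∀ p, g • block v (a p) (l p) (bef p) = ((x ^ (l p - a p)) (w p),
      (Submodule.Quotient.mk (∑ k ∈ Finset.range (l p - 1),
        wedge ((x ^ (l p - 1 - k)) (w p)) ((x ^ (k + 1)) (u p))) : V₂ n)) := by
    intro p
    have hbl := hble p
    have hap := hal p
    have hfst : g • (if a p = 0 then 0 else v (eps n (bef p + a p))) =
        ((x ^ (l p - a p)) (w p), (0 : V₂ n)) := by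
      by_cases h0 : a p = 0
      · rw [if_pos h0, smul_zero, h0, Nat.sub_zero, h.pow_w]
        rfl
      · rw [if_neg h0]
        have e := hc ⟨bef p + (a p - 1), by omega⟩
        simp only [show bef p + (a p - 1) + 1 = bef p + a p by omega] at e
        rw [e, Prod.smul_mk, smul_zero, smul_comm, hgE p (a p - 1) (by omega), smul_smul]
        have e2 : c (bef p + (a p - 1)) * σ p (a p - 1) = 1 := by
          simp only [σ, r]
          have := hc0 (bef p + (a p - 1))
          have := hD0 (bef p + (a p - 1))
          field_simp
        rw [e2, one_smul, show l p - 1 - (a p - 1) = l p - a p by omega]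
    have hsnd : ∀ k ∈ Finset.range (l p - 1), g • v (alpha n (bef p + (1 + k))) =
        (0, (Submodule.Quotient.mk
          (wedge ((x ^ (l p - 1 - k)) (w p)) ((x ^ (k + 1)) (u p))) : V₂ n)) := by
      intro k hk
      rw [Finset.mem_range] at hk
      have e := hd (bef p + k) (by omega)
      rw [show bef p + (1 + k) = bef p + k + 1 by omega, e, Prod.smul_mk, smul_zero, smul_comm,
        smul_mk_wedge, hgE p k (by omega), ← Submodule.Quotient.mk_smul]
      have e3 := hgF p (k + 1) (by omega) (by omega)
      simp only [← add_assoc] at e3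
      rw [e3, wedge_smul_smul, smul_smul]
      have e2 : d (bef p + k) * (σ p k * (σ p (k + 1))⁻¹) = 1 := by
        have h1 : σ p (k + 1) = d (bef p + k) * σ p k := by
          simp only [σ, D, ← add_assoc, Finset.prod_range_succ]
          ring
        rw [h1]
        have := hd0 (bef p + k)
        have := hσ0 p k
        field_simp
      rw [e2, one_smul]
    rw [block, smul_add, hfst, Finset.sum_Ico_eq_sum_range, Finset.smul_sum,
      Finset.sum_congr rfl hsnd]
    refine Prod.ext ?_ ?_
    · simp [Prod.fst_sum]
    · simp only [Prod.snd_add, Prod.snd_sum, zero_add]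
      exact (map_sum (Submodule.mkQ _) _ _).symm
  have hnf : normalForm v mp = ∑ p ∈ Finset.range m, block v (a p) (l p) (bef p) := by
    refine Finset.sum_subset ?_ ?_
    · intro p hp
      rw [Finsupp.mem_support_iff, hpart] at hp
      rw [Finset.mem_range]
      by_contra hpm
      exact hp (hlm p (by omega))
    · intro p _ hp
      rw [Finsupp.notMem_support_iff, hpart] at hp
      have := hal p
      rw [hmark, hpart, hp, show a p = 0 by omega]
      simp [block]
  rw [hnf, Finset.smul_sum, Finset.sum_congr rfl fun p _ => hblock p]
  refine Prod.ext ?_ ?_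
  · rw [Prod.fst_sum, hz]
  · rw [Prod.snd_sum]
    conv_rhs => rw [hy']
    exact (map_sum (Submodule.mkQ _) _ _).symm

end NormalForms

end ExoticCone

theorem theorem5p1 (n : ℕ) (v : ExoticCone.Weight n → ExoticCone.V n)
    (hv : ExoticCone.IsWeightBasis v) :
    Function.Surjective
      (ExoticCone.orbitMap hv : ExoticCone.MarkedPartition n → ExoticCone.Orbits n) := by
  intro q
  obtain ⟨⟨z, g₀, z₀, hz₀, rfl⟩, rfl⟩ := Quotient.exists_rep q
  obtain ⟨y, hy, e⟩ := ExoticCone.Vplus_snd_mem hz₀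
  obtain ⟨mp, g, hg⟩ := ExoticCone.exists_smul_normalForm hv z₀.1 y
    (ExoticCone.wedgeEnd_isNilpotent hy)
  refine ⟨mp, Quotient.sound ⟨g⁻¹ * g₀⁻¹, Subtype.ext ?_⟩⟩
  have hg' : g • ExoticCone.normalForm v mp = z₀ := by rw [hg, ← e]
  change (g⁻¹ * g₀⁻¹) • g₀ • z₀ = ExoticCone.normalForm v mp
  rw [mul_smul, inv_smul_smul, ← hg', inv_smul_smul]
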